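/- Let $n \ge 1$, let $\mathbb D^n \subset \mathbb C^n$ be the open unit polydisc, $\mathbb T^n$ the unit torus and $m_n$ the normalized Haar measure on $\mathbb T^n$. Let $\alpha, \beta \in \mathbb C^n$ satisfy $\operatorname{Re}\alpha_j + \operatorname{Re}\beta_j > -1$ and $\alpha_j, \beta_j \notin \{-1,-2,-3,\dots\}$ for all $1 \le j \le n$. A function $u \in C^2(\mathbb D^n)$ with values in $\mathbb C$ is called separately $(\alpha,\beta)$-harmonic if, on $\mathbb D^n$ and for every $1 \le j \le n$, $$(1-|z_j|^2)\frac{\partial^2 u}{\partial z_j\,\partial\overline{z_j}} + \alpha_j z_j \frac{\partial u}{\partial z_j} + \beta_j \overline{z_j}\,\frac{\partial u}{\partial \overline{z_j}} - \alpha_j\beta_j u = 0 .$$ The Poisson integral of a complex Borel measure $\mu$ on $\mathbb T^n$ is $$P_{\alpha,\beta}[d\mu](z) = \int_{\mathbb T^n} \prod_{j=1}^n \frac{\Gamma(\alpha_j+1)\Gamma(\beta_j+1)}{\Gamma(\alpha_j+\beta_j+1)}\, \frac{(1-|z_j|^2)^{\alpha_j+\beta_j+1}}{(1-z_j\overline{\zeta_j})^{\alpha_j+1}(1-\overline{z_j}\zeta_j)^{\beta_j+1}}\,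 d\mu(\zeta), \qquad z \in \mathbb D^n,$$ with principal branches of the powers. **Theorem.** If $u$ is separately $(\alpha,\beta)$-harmonic on $\mathbb D^n$ and $$\sup_{0 \le r < 1} \int_{\mathbb T^n} |u(r\zeta)|\, dm_n(\zeta) < \infty,$$ then there is a unique complex Borel measure $\mu$ on $\mathbb T^n$ such that $u(z) = P_{\alpha,\beta}[d\mu](z)$ for all $z \in \mathbb D^n$. -/

import Mathlib

open MeasureTheory

noncomputable section

namespace SepHarmonic

/-- The Borel σ-algebra on the unit circle. -/
instance instMeasurableSpaceCircle : MeasurableSpace Circle := borel Circle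

instance instBorelSpaceCircle : BorelSpace Circle := ⟨rfl⟩

/-- The unit torus `𝕋ⁿ`; as a finite product of second countable spaces its product σ-algebra
is its Borel σ-algebra. -/
abbrev Torus (n : ℕ) : Type := Fin n → Circle

/-- The normalized Haar measure `m_n` on `𝕋ⁿ`, i.e. the Haar measure of total mass one. -/
def torusMeasure (n : ℕ) : Measure (Torus n) :=
  Measure.haarMeasure (⊤ : TopologicalSpace.PositiveCompacts (Torus n))

/-- The open unit polydisc `𝔻ⁿ`. -/
def polydisc (n : ℕ) : Set (Fin n → ℂ) := {z | ∀ j, ‖z j‖ < 1}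

/-- The point `rζ = (rζ₁, …, rζₙ)`. -/
def dilate {n : ℕ} (r : ℝ) (ζ : Torus n) : Fin n → ℂ := fun j => (r : ℂ) * (ζ j : ℂ)

/-- `∂u/∂z_j = (∂u/∂x_j - i ∂u/∂y_j) / 2`. -/
def dz {n : ℕ} (j : Fin n) (u : (Fin n → ℂ) → ℂ) (z : Fin n → ℂ) : ℂ :=
  (fderiv ℝ u z (Pi.single j 1) - Complex.I * fderiv ℝ u z (Pi.single j Complex.I)) / 2

/-- `∂u/∂z̄_j = (∂u/∂x_j + i ∂u/∂y_j) / 2`. -/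
def dzbar {n : ℕ} (j : Fin n) (u : (Fin n → ℂ) → ℂ) (z : Fin n → ℂ) : ℂ :=
  (fderiv ℝ u z (Pi.single j 1) + Complex.I * fderiv ℝ u z (Pi.single j Complex.I)) / 2

/-- The operator `L_{a,b} = (1-|z_j|²) ∂²/∂z_j∂z̄_j + a z_j ∂/∂z_j + b z̄_j ∂/∂z̄_j - a b` acting in
the variable `z_j`. -/
def opL {n : ℕ} (a b : ℂ) (j : Fin n) (u : (Fin n → ℂ) → ℂ) (z : Fin n → ℂ) : ℂ :=
  (1 - (‖z j‖ : ℂ) ^ 2) * dz j (dzbar j u) z + a * z j * dz j u z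
    + b * starRingEnd ℂ (z j) * dzbar j u z - a * b * u z

/-- `u` is a separately `(α, β)`-harmonic function on `𝔻ⁿ` (its values off `𝔻ⁿ` play no role). -/
def IsSepHarmonic {n : ℕ} (α β : Fin n → ℂ) (u : (Fin n → ℂ) → ℂ) : Prop :=
  ContDiffOn ℝ 2 u (polydisc n) ∧ ∀ j, ∀ z ∈ polydisc n, opL (α j) (β j) j u z = 0

/-- `c_{a,b} = Γ(a+1) Γ(b+1) / Γ(a+b+1)`. -/
def coef (a b : ℂ) : ℂ :=
  Complex.Gamma (a + 1) * Complex.Gamma (b + 1) / Complex.Gamma (a + b + 1)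

/-- The `(α, β)`-Poisson kernel; the powers are principal ones, and on `𝔻ⁿ × 𝕋ⁿ` all their bases
have positive real part. -/
def abPoissonKernel {n : ℕ} (α β : Fin n → ℂ) (z : Fin n → ℂ) (ζ : Torus n) : ℂ :=
  ∏ j, coef (α j) (β j) *
    ((1 - (‖z j‖ : ℂ) ^ 2) ^ (α j + β j + 1) /
      ((1 - z j * starRingEnd ℂ (ζ j : ℂ)) ^ (α j + 1) *
        (1 - starRingEnd ℂ (z j) * (ζ j : ℂ)) ^ (β j + 1)))

/-- The Poisson integral `P_{α,β}[dμ](z) = ∫ P_{α,β}(z, ζ) dμ(ζ)` of a complex Borel measure `μ`,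
where values of the integrand and of `μ` are paired by multiplication in `ℂ`. -/
def poissonIntegral {n : ℕ} (α β : Fin n → ℂ) (μ : ComplexMeasure (Torus n))
    (z : Fin n → ℂ) : ℂ :=
  μ.integral (fun ζ => abPoissonKernel α β z ζ) (ContinuousLinearMap.mul ℝ ℂ)

end SepHarmonic

end

/-! In each variable the equation is invariant under rotations, so the Fourier coefficients of a
solution on circles |z| = r decouple: the m-th one satisfies a second-order linear radial equation,
written here as the first-order `RadialSystem`. Its solutions regular at the origin are proportional
to each other (`RadialSystem.mul_eq_mul`), because their Wronskian vanishes. The Poisson kernel with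
pole at 1 solves the same equation (`isHarmonicJet_diskKernel`). Hence the k-th Fourier coefficient
of u on the torus of radii r₁, …, rₙ is c_k ∏ κ_j(r_j), where κ_j is the k_j-th coefficient of the
normalized kernel in the j-th variable and c_k is a constant (`exists_torusCoeff_eq`).

The Gamma factors are chosen so that κ_j(r) → 1 as r → 1
(`tendsto_coef_mul_circleCoeff_diskKernel`). This comes from the binomial series, Euler's limit for
Γ and an Abelian theorem with exponent s = α_j + β_j + 1, where Re s > 0 is needed; excluding
negative integers keeps Γ(α_j + 1) and Γ(β_j + 1) free of poles.

By the L¹ bound, the measures u(rζ) dm_n have a weak limit point μ as r → 1 (`exists_weak_limit`).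
Along that limit the k-th coefficient of u tends both to the Fourier coefficient of μ and to c_k, so
the two agree. The Poisson integral of μ has coefficients μ̂(k) ∏ κ_j(r_j)
(`torusCoeff_poissonIntegral`), the same as u on every torus, and therefore equals u. For
uniqueness, no κ_j is identically zero, so a Poisson integral determines μ̂; density of
trigonometric polynomials then determines μ. -/

noncomputable section

namespace SepHarmonic

open Filter Topology Set
open scoped ComplexConjugate

/-! ### Haar measure, characters and Fourier uniqueness on the torus. -/

section Torus

/-- The normalized Haar measure on the unit circle. -/
def circleMeasure : Measure Circle :=
  Measure.haarMeasure (⊤ : TopologicalSpace.PositiveCompacts Circle)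

instance instIsHaarMeasureCircleMeasure : circleMeasure.IsHaarMeasure :=
  inferInstanceAs (Measure.haarMeasure _).IsHaarMeasure

instance instIsProbabilityMeasureCircleMeasure : IsProbabilityMeasure circleMeasure :=
  ⟨by
    have := Measure.haarMeasure_self (K₀ := (⊤ : TopologicalSpace.PositiveCompacts Circle))
    simpa [circleMeasure] using this⟩

variable {n : ℕ}

instance instIsHaarMeasureTorusMeasure : (torusMeasure n).IsHaarMeasure :=
  inferInstanceAs (Measure.haarMeasure _).IsHaarMeasure

instance instIsProbabilityMeasureTorusMeasure : IsProbabilityMeasure (torusMeasure n) :=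
  ⟨by
    have := Measure.haarMeasure_self (K₀ := (⊤ : TopologicalSpace.PositiveCompacts (Torus n)))
    simpa [torusMeasure] using this⟩

/-- This makes the integral of a product of one-variable functions factor. -/
theorem torusMeasure_eq_pi : torusMeasure n = Measure.pi fun _ => circleMeasure := by
  have h := Measure.haarMeasure_unique (Measure.pi fun _ : Fin n => circleMeasure)
    (⊤ : TopologicalSpace.PositiveCompacts (Torus n))
  simpa [torusMeasure] using h.symm

/-- Integrals against the rotation invariant measure of the circle of nontrivial characters
vanish. -/
theorem integral_circle_zpow (k : ℤ) :
    ∫ w : Circle, (w : ℂ) ^ k ∂circleMeasure = if k = 0 then 1 else 0 := by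
  split_ifs with hk
  · simp [hk]
  · have hinv (c : Circle) : ∫ w : Circle, (w : ℂ) ^ k ∂circleMeasure
        = (c : ℂ) ^ k * ∫ w : Circle, (w : ℂ) ^ k ∂circleMeasure := by
      rw [← integral_const_mul, ← integral_mul_left_eq_self _ c]
      simp [mul_zpow]
    by_contra h
    have hone (c : Circle) : (c : ℂ) ^ k = 1 := by
      have := hinv c
      field_simp at this
      exact this.symm
    -- Every k-th power would be 1, yet the k-th power of exp(iπ/k) is -1.
    have hc := hone (Circle.exp (Real.pi / k))
    rw [← Circle.coe_zpow, ← Circle.exp_zsmul] at hc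
    have hk' : (k : ℝ) ≠ 0 := by exact_mod_cast hk
    rw [zsmul_eq_mul, mul_div_cancel₀ _ hk'] at hc
    norm_num [Circle.coe_exp, Complex.exp_pi_mul_I] at hc

/-- The character `ζ ↦ ζ^k` of the torus. -/
def character (k : Fin n → ℤ) : C(Torus n, ℂ) where
  toFun ζ := ∏ j, ((ζ j ^ k j : Circle) : ℂ)
  continuous_toFun := continuous_finsetProd _ fun j _ =>
    continuous_subtype_val.comp ((continuous_apply j).zpow (k j))

theorem character_apply (k : Fin n → ℤ) (ζ : Torus n) :
    character k ζ = ∏ j, ((ζ j ^ k j : Circle) : ℂ) := rfl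

theorem character_apply_mul (k : Fin n → ℤ) (ζ η : Torus n) :
    character k (ζ * η) = character k ζ * character k η := by
  simp [character_apply, mul_zpow, Finset.prod_mul_distrib]

theorem character_add (k l : Fin n → ℤ) : character (k + l) = character k * character l := by
  ext ζ
  simp only [character_apply, ContinuousMap.mul_apply, Pi.add_apply, zpow_add, Circle.coe_mul,
    Finset.prod_mul_distrib]

theorem character_zero : character (0 : Fin n → ℤ) = 1 := by
  ext ζ
  simp [character_apply]

theorem star_character (k : Fin n → ℤ) : star (character k) = character (-k) := by
  ext ζ
  simp [character_apply, ← Circle.coe_inv_eq_conj]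

/-- The star algebra of trigonometric polynomials on the torus. -/
def trigPolynomials (n : ℕ) : StarSubalgebra ℂ C(Torus n, ℂ) where
  toSubalgebra := Algebra.adjoin ℂ (range character)
  star_mem' := by
    change Algebra.adjoin ℂ (range (character (n := n))) ≤
      star (Algebra.adjoin ℂ (range (character (n := n))))
    refine Algebra.adjoin_le ?_
    rintro - ⟨k, rfl⟩
    exact Algebra.subset_adjoin ⟨-k, (star_character k).symm⟩

theorem trigPolynomials_coe :
    Subalgebra.toSubmodule (trigPolynomials n).toSubalgebra
      = Submodule.span ℂ (range (character (n := n))) := by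
  refine Algebra.adjoin_eq_span_of_subset _ (Subset.trans ?_ Submodule.subset_span)
  intro x hx
  refine Submonoid.closure_induction (fun _ => id) ⟨0, character_zero⟩ ?_ hx
  rintro - - - - ⟨k, rfl⟩ ⟨l, rfl⟩
  exact ⟨k + l, character_add k l⟩

theorem trigPolynomials_separatesPoints :
    (trigPolynomials n).SeparatesPoints := by
  intro x y hxy
  obtain ⟨j, hj⟩ := Function.ne_iff.mp hxy
  refine ⟨_, ⟨character (Pi.single j 1), Algebra.subset_adjoin ⟨_, rfl⟩, rfl⟩, ?_⟩
  have h (ζ : Torus n) : character (Pi.single j 1) ζ = ζ j := by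
    rw [character_apply, Finset.prod_eq_single j] <;> simp +contextual
  simpa only [h, ne_eq, Circle.coe_inj] using hj

theorem span_character_closure_eq_top :
    (Submodule.span ℂ (range (character (n := n)))).topologicalClosure = ⊤ := by
  rw [← trigPolynomials_coe]
  exact congrArg (Subalgebra.toSubmodule <| StarSubalgebra.toSubalgebra ·)
    (ContinuousMap.starSubalgebra_topologicalClosure_eq_top_of_separatesPoints _
      trigPolynomials_separatesPoints)

theorem clm_ext_character {f g : C(Torus n, ℂ) →L[ℂ] ℂ}
    (h : ∀ k, f (character k) = g (character k)) : f = g :=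
  ContinuousLinearMap.ext_on
    (by simpa [Submodule.dense_iff_topologicalClosure_eq_top] using span_character_closure_eq_top)
    (by rintro - ⟨k, rfl⟩; exact h k)

/-- Integration against a finite measure, as a functional on continuous functions. -/
def integralFunctional (m : Measure (Torus n)) [IsFiniteMeasure m] : C(Torus n, ℂ) →L[ℂ] ℂ :=
  LinearMap.mkContinuous
    { toFun := fun F => ∫ ζ, F ζ ∂m
      map_add' := fun F G => integral_add
        (F.continuous.integrable_of_hasCompactSupport (HasCompactSupport.of_compactSpace _))
        (G.continuous.integrable_of_hasCompactSupport (HasCompactSupport.of_compactSpace _))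
      map_smul' := fun c F => integral_smul c _ }
    (m.real univ) fun F => by
      rw [mul_comm]
      exact norm_integral_le_of_norm_le_const (.of_forall fun ζ => F.norm_coe_le_norm ζ)

theorem integralFunctional_apply (m : Measure (Torus n)) [IsFiniteMeasure m] (F : C(Torus n, ℂ)) :
    integralFunctional m F = ∫ ζ, F ζ ∂m := rfl

theorem continuous_integrable {m : Measure (Torus n)} [IsFiniteMeasure m] {F : Torus n → ℂ}
    (hF : Continuous F) : Integrable F m :=
  hF.integrable_of_hasCompactSupport (HasCompactSupport.of_compactSpace _)

/-- A continuous function on the torus is determined by its Fourier coefficients. -/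
theorem eq_of_fourierCoeff_eq {f g : Torus n → ℂ} (hf : Continuous f) (hg : Continuous g)
    (h : ∀ k, ∫ ζ, f ζ * character k ζ ∂torusMeasure n = ∫ ζ, g ζ * character k ζ ∂torusMeasure n) :
    f = g := by
  let d : C(Torus n, ℂ) := ⟨fun ζ => f ζ - g ζ, hf.sub hg⟩
  have hd : (integralFunctional (torusMeasure n)).comp (ContinuousLinearMap.mul ℂ _ d) = 0 := by
    refine clm_ext_character fun k => ?_
    simp only [ContinuousLinearMap.comp_apply, integralFunctional_apply,
      ContinuousLinearMap.mul_apply', ContinuousMap.mul_apply, zero_apply]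
    simp only [d, ContinuousMap.coe_mk, sub_mul]
    rw [integral_sub (continuous_integrable (by fun_prop)) (continuous_integrable (by fun_prop)),
      h, sub_self]
  have h0 : ∫ ζ, ‖d ζ‖ ^ 2 ∂torusMeasure n = 0 := by
    -- The functional F ↦ ∫ d F vanishes on characters, hence everywhere; testing on the conjugate
    -- of d gives the L² norm.
    have := DFunLike.congr_fun hd (star d)
    simp only [ContinuousLinearMap.comp_apply, integralFunctional_apply,
      ContinuousLinearMap.mul_apply', ContinuousMap.mul_apply, zero_apply,
      ContinuousMap.star_apply, RCLike.star_def, Complex.mul_conj, Complex.normSq_eq_norm_sq] at this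
    rw [← Complex.ofReal_inj, Complex.ofReal_zero, ← this, ← integral_complex_ofReal]
  have hc : Continuous fun ζ => ‖d ζ‖ ^ 2 := by fun_prop
  ext ζ
  by_contra hne
  refine (hc.integral_pos_of_hasCompactSupport_nonneg_nonzero (μ := torusMeasure n) (x := ζ)
    (HasCompactSupport.of_compactSpace _) (fun ζ => by positivity) ?_).ne' h0
  simpa [d, sub_eq_zero] using hne

end Torus

/-! ### Complex measures as combinations m₀ + i m₁ - m₂ - i m₃ of finite measures. -/

section ComplexMeasures

variable {X : Type*} [MeasurableSpace X]

/-- The complex measure `c • m` for a finite measure `m` and `c : ℂ`. -/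
def scaledMeasure (m : Measure X) [IsFiniteMeasure m] (c : ℂ) : ComplexMeasure X :=
  m.toSignedMeasure.mapRange
    (((ContinuousLinearMap.id ℝ ℝ).smulRight c : ℝ →L[ℝ] ℂ) : ℝ →ₗ[ℝ] ℂ).toAddMonoidHom
    ((ContinuousLinearMap.id ℝ ℝ).smulRight c : ℝ →L[ℝ] ℂ).continuous

theorem scaledMeasure_apply (m : Measure X) [IsFiniteMeasure m] (c : ℂ) {s : Set X}
    (hs : MeasurableSet s) : scaledMeasure m c s = m.real s * c := by
  simp [scaledMeasure, hs]

theorem variation_scaledMeasure_le (m : Measure X) [IsFiniteMeasure m] (c : ℂ) :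
    (scaledMeasure m c).variation ≤ ‖c‖ₑ • m := by
  refine VectorMeasure.variation_le_of_forall_enorm_le fun s hs => ?_
  rw [scaledMeasure_apply m c hs, enorm_mul, mul_comm, Measure.smul_apply, smul_eq_mul]
  gcongr
  rw [← ofReal_norm]
  simp [Measure.real]

theorem integral_scaledMeasure (m : Measure X) [IsFiniteMeasure m] (c : ℂ) {f : X → ℂ}
    (hf : Integrable f m) :
    (scaledMeasure m c).integral f (ContinuousLinearMap.mul ℝ ℂ) = c * ∫ x, f x ∂m := by
  set T := (scaledMeasure m c).transpose (ContinuousLinearMap.mul ℝ ℂ)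
  have hT := dominatedFinMeasAdditive_cbmApplyMeasure (scaledMeasure m c)
    (ContinuousLinearMap.mul ℝ ℂ)
  -- The integral is built over the variation; as ‖c‖ m dominates it, the integral can be computed
  -- over m, where induction on integrable functions is available.
  have hT' := DominatedFinMeasAdditive.of_measure_le_smul (by simp)
    (variation_scaledMeasure_le m c) hT (by positivity)
  rw [VectorMeasure.integral_eq_setToFun, ← setToFun_congr_measure_of_integrable _ (by simp)
    (variation_scaledMeasure_le m c) hT' hT f hf]
  refine Integrable.induction (fun g => setToFun m T hT' g = c * ∫ x, g x ∂m) ?_ ?_ ?_ ?_ hf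
  · intro a s hs hms
    rw [setToFun_indicator_const _ hs hms.ne, integral_indicator_const _ hs]
    change a * scaledMeasure m c s = _
    rw [scaledMeasure_apply m c hs, Complex.real_smul]
    ring
  · intro f g _ hfi hgi hf hg
    rw [setToFun_add _ hfi hgi, hf, hg, integral_add' hfi hgi, mul_add]
  · exact isClosed_eq (continuous_setToFun hT') (continuous_const.mul continuous_integral)
  · intro f g hfg _ hf
    rw [← setToFun_congr_ae _ hfg, hf, integral_congr_ae hfg]

/-- The complex measure `m₀ + i m₁ - m₂ - i m₃`. -/
def quadMeasure (m : Fin 4 → FiniteMeasure X) : ComplexMeasure X :=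
  ∑ i : Fin 4, scaledMeasure (m i : Measure X) (Complex.I ^ (i : ℕ))

theorem integral_quadMeasure (m : Fin 4 → FiniteMeasure X) {f : X → ℂ}
    (hf : ∀ i, Integrable f (m i : Measure X)) :
    (quadMeasure m).integral f (ContinuousLinearMap.mul ℝ ℂ)
      = ∑ i : Fin 4, Complex.I ^ (i : ℕ) * ∫ x, f x ∂(m i : Measure X) := by
  rw [quadMeasure, VectorMeasure.integral_finsetSum_vectorMeasure]
  · exact Finset.sum_congr rfl fun i _ => integral_scaledMeasure _ _ (hf i)
  · intro i _
    exact ((hf i).smul_measure (by simp)).mono_measure (variation_scaledMeasure_le _ _)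

/-- Jordan decomposition of the real and imaginary parts. It reduces uniqueness among all complex
measures to uniqueness in this form. -/
theorem exists_quadMeasure_eq (μ : ComplexMeasure X) : ∃ m, quadMeasure m = μ := by
  let jr := (ComplexMeasure.re μ).toJordanDecomposition
  let ji := (ComplexMeasure.im μ).toJordanDecomposition
  refine ⟨![⟨jr.posPart, inferInstance⟩, ⟨ji.posPart, inferInstance⟩,
    ⟨jr.negPart, inferInstance⟩, ⟨ji.negPart, inferInstance⟩], ?_⟩
  ext s hs
  have hr : (μ s).re = jr.posPart.real s - jr.negPart.real s :=
    SignedMeasure.apply_eq_posPart_real_sub_negPart_real (ComplexMeasure.re μ) hs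
  have hi : (μ s).im = ji.posPart.real s - ji.negPart.real s :=
    SignedMeasure.apply_eq_posPart_real_sub_negPart_real (ComplexMeasure.im μ) hs
  rw [← Complex.re_add_im (μ s), hr, hi]
  simp [quadMeasure, Fin.sum_univ_four, scaledMeasure_apply _ _ hs, pow_succ]
  ring

theorem quadMeasure_apply (m : Fin 4 → FiniteMeasure X) {s : Set X} (hs : MeasurableSet s) :
    quadMeasure m s = ((m 0 : Measure X).real s - (m 2 : Measure X).real s : ℝ)
      + ((m 1 : Measure X).real s - (m 3 : Measure X).real s : ℝ) * Complex.I := by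
  simp [quadMeasure, Fin.sum_univ_four, scaledMeasure_apply _ _ hs, pow_succ]
  ring

/-- Pairing of a continuous function with `m₀ + i m₁ - m₂ - i m₃`. -/
def quadFunctional {n : ℕ} (m : Fin 4 → FiniteMeasure (Torus n)) : C(Torus n, ℂ) →L[ℂ] ℂ :=
  ∑ i : Fin 4, Complex.I ^ (i : ℕ) • integralFunctional (m i : Measure (Torus n))

theorem quadFunctional_apply {n : ℕ} (m : Fin 4 → FiniteMeasure (Torus n)) (F : C(Torus n, ℂ)) :
    quadFunctional m F = ∑ i : Fin 4, Complex.I ^ (i : ℕ) * ∫ ζ, F ζ ∂(m i : Measure (Torus n)) := by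
  simp [quadFunctional, integralFunctional_apply]

theorem integral_quadMeasure_eq {n : ℕ} (m : Fin 4 → FiniteMeasure (Torus n))
    (F : C(Torus n, ℂ)) :
    (quadMeasure m).integral F (ContinuousLinearMap.mul ℝ ℂ) = quadFunctional m F := by
  rw [integral_quadMeasure m fun i => continuous_integrable F.continuous, quadFunctional_apply]

/-- On real test functions the real part of the pairing sees only m₀ - m₂ and the imaginary part
only m₁ - m₃, so the claim splits into two statements on differences of positive measures. -/
theorem quadMeasure_eq_of_quadFunctional_eq {n : ℕ} {m m' : Fin 4 → FiniteMeasure (Torus n)}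
    (h : quadFunctional m = quadFunctional m') : quadMeasure m = quadMeasure m' := by
  have key (F : BoundedContinuousFunction (Torus n) ℝ) :
      (∫ ζ, F ζ ∂(m 0 : Measure (Torus n)) - ∫ ζ, F ζ ∂(m 2 : Measure (Torus n))
        = ∫ ζ, F ζ ∂(m' 0 : Measure (Torus n)) - ∫ ζ, F ζ ∂(m' 2 : Measure (Torus n))) ∧
      (∫ ζ, F ζ ∂(m 1 : Measure (Torus n)) - ∫ ζ, F ζ ∂(m 3 : Measure (Torus n))
        = ∫ ζ, F ζ ∂(m' 1 : Measure (Torus n)) - ∫ ζ, F ζ ∂(m' 3 : Measure (Torus n))) := by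
    have hF := DFunLike.congr_fun h
      (⟨fun ζ => (F ζ : ℂ), Complex.continuous_ofReal.comp F.continuous⟩ : C(Torus n, ℂ))
    simp only [quadFunctional_apply, ContinuousMap.coe_mk, integral_complex_ofReal,
      Fin.sum_univ_four] at hF
    constructor
    · have := congrArg Complex.re hF
      simp [pow_succ] at this
      linarith
    · have := congrArg Complex.im hF
      simp [pow_succ] at this
      linarith
  have hint (ν : FiniteMeasure (Torus n)) (F : BoundedContinuousFunction (Torus n) ℝ) :
      Integrable F (ν : Measure (Torus n)) := F.integrable _
  have ext (a b c d : FiniteMeasure (Torus n))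
      (H : ∀ F : BoundedContinuousFunction (Torus n) ℝ,
        ∫ ζ, F ζ ∂(a : Measure (Torus n)) - ∫ ζ, F ζ ∂(b : Measure (Torus n))
          = ∫ ζ, F ζ ∂(c : Measure (Torus n)) - ∫ ζ, F ζ ∂(d : Measure (Torus n))) (s : Set (Torus n)) :
      (a : Measure (Torus n)).real s - (b : Measure (Torus n)).real s
        = (c : Measure (Torus n)).real s - (d : Measure (Torus n)).real s := by
    -- Moving the negative terms across turns an identity of differences into one of positive
    -- measures, which integrals of continuous functions determine.
    have hm : (a : Measure (Torus n)) + d = c + b := by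
      refine ext_of_forall_integral_eq_of_IsFiniteMeasure fun F => ?_
      rw [integral_add_measure (hint _ _) (hint _ _), integral_add_measure (hint _ _) (hint _ _)]
      linarith [H F]
    have : ((a : Measure (Torus n)) + (d : Measure (Torus n))).real s
        = ((c : Measure (Torus n)) + (b : Measure (Torus n))).real s := by rw [hm]
    rw [measureReal_add_apply, measureReal_add_apply] at this
    linarith
  ext1 s hs
  rw [quadMeasure_apply m hs, quadMeasure_apply m' hs, ext _ _ _ _ (fun F => (key F).1),
    ext _ _ _ _ (fun F => (key F).2)]

end ComplexMeasures

/-! ### The radial system and proportionality of its regular solutions. -/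

section LinearSystems

/-- Uniqueness for planar linear systems of differential equations with continuous
coefficients. -/
theorem linear_system_eq_zero {c₁ c₂ c₃ c₄ f g : ℝ → ℂ} {s : ℝ} (hs : s ∈ Ioo (0 : ℝ) 1)
    (h₁ : ContinuousOn c₁ (Ioo 0 1)) (h₂ : ContinuousOn c₂ (Ioo 0 1))
    (h₃ : ContinuousOn c₃ (Ioo 0 1)) (h₄ : ContinuousOn c₄ (Ioo 0 1))
    (hf : ∀ t ∈ Ioo (0 : ℝ) 1, HasDerivAt f (c₁ t * f t + c₂ t * g t) t)
    (hg : ∀ t ∈ Ioo (0 : ℝ) 1, HasDerivAt g (c₃ t * f t + c₄ t * g t) t)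
    (hfs : f s = 0) (hgs : g s = 0) {t : ℝ} (ht : t ∈ Ioo (0 : ℝ) 1) : f t = 0 := by
  -- The coefficients may blow up at 0 and 1, so uniqueness is applied on a compact [δ, ρ] around s
  -- and t, where they are bounded and the field is Lipschitz.
  obtain ⟨δ, hδ0, hδ⟩ : ∃ δ, 0 < δ ∧ δ < min s t := exists_between (lt_min hs.1 ht.1)
  obtain ⟨ρ, hρ, hρ1⟩ : ∃ ρ, max s t < ρ ∧ ρ < 1 := exists_between (max_lt hs.2 ht.2)
  rw [lt_min_iff] at hδ
  rw [max_lt_iff] at hρ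
  have hsub : Icc δ ρ ⊆ Ioo 0 1 := fun x hx => ⟨hδ0.trans_le hx.1, hx.2.trans_lt hρ1⟩
  obtain ⟨C₁, hC₁⟩ := isCompact_Icc.exists_bound_of_continuousOn (h₁.mono hsub)
  obtain ⟨C₂, hC₂⟩ := isCompact_Icc.exists_bound_of_continuousOn (h₂.mono hsub)
  obtain ⟨C₃, hC₃⟩ := isCompact_Icc.exists_bound_of_continuousOn (h₃.mono hsub)
  obtain ⟨C₄, hC₄⟩ := isCompact_Icc.exists_bound_of_continuousOn (h₄.mono hsub)
  set C := max (C₁ + C₂) (C₃ + C₄)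
  have hest {t : ℝ} (d₁ d₂ : ℂ) {D₁ D₂ : ℝ} (e₁ : ‖d₁‖ ≤ D₁) (e₂ : ‖d₂‖ ≤ D₂) (x y : ℂ × ℂ) :
      dist (d₁ * x.1 + d₂ * x.2) (d₁ * y.1 + d₂ * y.2) ≤ (D₁ + D₂) * dist x y := by
    rw [dist_eq_norm, show d₁ * x.1 + d₂ * x.2 - (d₁ * y.1 + d₂ * y.2)
      = d₁ * (x.1 - y.1) + d₂ * (x.2 - y.2) by ring, add_mul]
    refine (norm_add_le _ _).trans ?_
    rw [norm_mul, norm_mul, ← dist_eq_norm, ← dist_eq_norm, Prod.dist_eq]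
    have := dist_nonneg (x := x.1) (y := y.1)
    gcongr
    · exact (norm_nonneg _).trans e₁
    · exact le_max_left _ _
    · exact (norm_nonneg _).trans e₂
    · exact le_max_right _ _
  have key := ODE_solution_unique_of_mem_Ioo
    (v := fun t (x : ℂ × ℂ) => (c₁ t * x.1 + c₂ t * x.2, c₃ t * x.1 + c₄ t * x.2))
    (s := fun _ => univ) (K := C.toNNReal) (f := fun t => (f t, g t)) (g := fun _ => (0, 0))
    (a := δ) (b := ρ) (t₀ := s)
    (fun t ht => by
      have ht' := Ioo_subset_Icc_self ht
      refine (LipschitzWith.of_dist_le_mul fun x y => ?_).lipschitzOnWith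
      rw [Prod.dist_eq (x := (_, _))]
      refine max_le ((hest (t := t) _ _ (hC₁ t ht') (hC₂ t ht') x y).trans ?_)
        ((hest (t := t) _ _ (hC₃ t ht') (hC₄ t ht') x y).trans ?_)
      · gcongr
        exact (le_max_left _ _).trans (Real.le_coe_toNNReal C)
      · gcongr
        exact (le_max_right _ _).trans (Real.le_coe_toNNReal C))
    ⟨hδ.1, hρ.1⟩
    (fun t ht => ⟨(hf t (hsub (Ioo_subset_Icc_self ht))).prodMk
      (hg t (hsub (Ioo_subset_Icc_self ht))), mem_univ _⟩)
    (fun t ht => ⟨by simpa [Prod.mk_zero_zero] using hasDerivAt_const t ((0, 0) : ℂ × ℂ), mem_univ _⟩)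
    (by simp [hfs, hgs])
  exact congrArg Prod.fst (key ⟨hδ.2, hρ.2⟩)

/-- The radial system satisfied by the `m`-th Fourier coefficients `f`, `g` of `v` and `z̄ ∂v/∂z̄`,
where `v` is `(a, b)`-harmonic in the disc. -/
structure RadialSystem (a b : ℂ) (m : ℤ) (f g : ℝ → ℂ) : Prop where
  hasDerivAt_fst : ∀ r ∈ Ioo (0 : ℝ) 1, HasDerivAt f (m / r * f r + 2 / r * g r) r
  hasDerivAt_snd : ∀ r ∈ Ioo (0 : ℝ) 1, HasDerivAt g
    (2 * r * (a * b - a * m) / (1 - r ^ 2) * f r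
      + (-m / r - 2 * r * (a + b) / (1 - r ^ 2)) * g r) r
  continuousOn_fst : ContinuousOn f (Ico 0 1)
  continuousOn_snd : ContinuousOn g (Ico 0 1)
  snd_zero : g 0 = 0

theorem one_sub_sq_ne_zero {r : ℝ} (hr : r ∈ Ico (0 : ℝ) 1) : (1 : ℂ) - (r : ℂ) ^ 2 ≠ 0 := by
  have : (1 : ℝ) - r ^ 2 ≠ 0 := by nlinarith [hr.1, hr.2]
  exact_mod_cast this

namespace RadialSystem

variable {a b : ℂ} {m : ℤ} {f₁ g₁ f₂ g₂ : ℝ → ℂ}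

/-- In the trace of the system the terms ±m/r cancel, leaving W' = -2r(a+b)/(1-r²) W. Thus
(1-r²)^(-(a+b)) W is constant, has no singularity at 0, and vanishes there since both second
components do. -/
theorem wronskian_eq_zero (h₁ : RadialSystem a b m f₁ g₁) (h₂ : RadialSystem a b m f₂ g₂)
    {r : ℝ} (hr : r ∈ Ioo (0 : ℝ) 1) : f₁ r * g₂ r - f₂ r * g₁ r = 0 := by
  let E : ℝ → ℂ := fun t => Complex.exp (-(a + b) * (Real.log (1 - t ^ 2) : ℝ))
  let X : ℝ → ℂ := fun t => (f₁ t * g₂ t - f₂ t * g₁ t) * E t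
  have hpos {t : ℝ} (ht : t ∈ Ico (0 : ℝ) 1) : 0 < 1 - t ^ 2 := by nlinarith [ht.1, ht.2]
  have hE {t : ℝ} (ht : t ∈ Ico (0 : ℝ) 1) :
      HasDerivAt E (E t * ((a + b) * (2 * t / (1 - t ^ 2)))) t := by
    have hlog : HasDerivAt (fun t : ℝ => Real.log (1 - t ^ 2)) (-(2 * t) / (1 - t ^ 2)) t := by
      convert! ((hasDerivAt_pow 2 t).const_sub 1).log (hpos ht).ne' using 1
      simp
    convert! (hlog.ofReal_comp.const_mul (-(a + b))).cexp using 1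
    push_cast
    ring
  have hX {t : ℝ} (ht : t ∈ Ioo (0 : ℝ) 1) : HasDerivAt X 0 t := by
    have ht' := Ioo_subset_Ico_self ht
    have ht0 : (t : ℂ) ≠ 0 := by exact_mod_cast ht.1.ne'
    have hne := one_sub_sq_ne_zero ht'
    convert! (((h₁.hasDerivAt_fst t ht).mul (h₂.hasDerivAt_snd t ht)).sub
      ((h₂.hasDerivAt_fst t ht).mul (h₁.hasDerivAt_snd t ht))).mul (hE ht') using 1
    simp only [Pi.sub_apply, Pi.mul_apply]
    field_simp
    ring
  have hcX : ContinuousOn X (Ico 0 1) :=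
    ((h₁.continuousOn_fst.mul h₂.continuousOn_snd).sub
      (h₂.continuousOn_fst.mul h₁.continuousOn_snd)).mul
        fun t ht => (hE ht).continuousAt.continuousWithinAt
  have hconst : ∀ δ ∈ Ioo 0 r, X δ = X r := by
    intro δ hδ
    refine (constant_of_has_deriv_right_zero
      (hcX.mono fun x hx => ⟨hδ.1.le.trans hx.1, hx.2.trans_lt hr.2⟩)
      (fun x hx => (hX ⟨hδ.1.trans_le hx.1, hx.2.trans hr.2⟩).hasDerivWithinAt) r
      ⟨hδ.2.le, le_rfl⟩).symm
  have hlim : Tendsto X (𝓝[>] 0) (𝓝 (X 0)) :=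
    (hcX 0 ⟨le_rfl, one_pos⟩).mono_left
      (le_of_eq_of_le (nhdsWithin_Ioo_eq_nhdsGT one_pos).symm
        (nhdsWithin_mono _ Ioo_subset_Ico_self))
  have hX0 : X r = X 0 := by
    refine tendsto_nhds_unique (tendsto_const_nhds.congr' ?_) hlim
    filter_upwards [Ioo_mem_nhdsGT hr.1] with δ hδ using (hconst δ hδ).symm
  have : X r = 0 := by simp [hX0, X, h₁.snd_zero, h₂.snd_zero]
  exact (mul_eq_zero.mp this).resolve_right (Complex.exp_ne_zero _)

/-- Solutions of the radial system that are regular at the origin are proportional. -/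
theorem mul_eq_mul (h₁ : RadialSystem a b m f₁ g₁) (h₂ : RadialSystem a b m f₂ g₂)
    {r s : ℝ} (hr : r ∈ Ico (0 : ℝ) 1) (hs : s ∈ Ioo (0 : ℝ) 1) :
    f₁ r * f₂ s = f₁ s * f₂ r := by
  -- This combination of the two solutions has first component 0 at s by construction and second
  -- component 0 at s by the Wronskian, so it is the zero solution. The value r = 0 is then reached
  -- by continuity.
  have hpos {r : ℝ} (hr : r ∈ Ioo (0 : ℝ) 1) : f₁ r * f₂ s - f₁ s * f₂ r = 0 := by
    refine linear_system_eq_zero (f := fun r => f₁ r * f₂ s - f₁ s * f₂ r)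
      (g := fun r => g₁ r * f₂ s - f₁ s * g₂ r) (c₁ := fun r => m / r) (c₂ := fun r => 2 / r)
      (c₃ := fun r => 2 * r * (a * b - a * m) / (1 - r ^ 2))
      (c₄ := fun r => -m / r - 2 * r * (a + b) / (1 - r ^ 2)) hs ?_ ?_ ?_ ?_ ?_ ?_ ?_ ?_ hr
    · exact fun t ht => ContinuousAt.continuousWithinAt
        (by have : (t : ℂ) ≠ 0 := by exact_mod_cast ht.1.ne'
            fun_prop (disch := assumption))
    · exact fun t ht => ContinuousAt.continuousWithinAt
        (by have : (t : ℂ) ≠ 0 := by exact_mod_cast ht.1.ne'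
            fun_prop (disch := assumption))
    · exact fun t ht => ContinuousAt.continuousWithinAt
        (by have := one_sub_sq_ne_zero (Ioo_subset_Ico_self ht)
            fun_prop (disch := assumption))
    · exact fun t ht => ContinuousAt.continuousWithinAt
        (by have : (t : ℂ) ≠ 0 := by exact_mod_cast ht.1.ne'
            have := one_sub_sq_ne_zero (Ioo_subset_Ico_self ht)
            fun_prop (disch := assumption))
    · intro t ht
      convert! ((h₁.hasDerivAt_fst t ht).mul_const (f₂ s)).sub
        ((h₂.hasDerivAt_fst t ht).const_mul (f₁ s)) using 1
      ring
    · intro t ht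
      convert! ((h₁.hasDerivAt_snd t ht).mul_const (f₂ s)).sub
        ((h₂.hasDerivAt_snd t ht).const_mul (f₁ s)) using 1
      ring
    · simp
    · linear_combination -wronskian_eq_zero h₁ h₂ hs
  rcases eq_or_lt_of_le hr.1 with rfl | h0
  · have hc : ContinuousOn (fun r => f₁ r * f₂ s - f₁ s * f₂ r) (Ico 0 1) :=
      (h₁.continuousOn_fst.mul_const _).sub (h₂.continuousOn_fst.const_mul _)
    have hlim := (hc 0 ⟨le_rfl, one_pos⟩).mono_left
      (le_of_eq_of_le (nhdsWithin_Ioo_eq_nhdsGT one_pos).symm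
        (nhdsWithin_mono _ Ioo_subset_Ico_self))
    refine sub_eq_zero.mp (tendsto_nhds_unique hlim (tendsto_const_nhds.congr' ?_))
    filter_upwards [Ioo_mem_nhdsGT one_pos] with δ hδ using (hpos hδ).symm
  · exact sub_eq_zero.mp (hpos ⟨h0, hr.2⟩)

end RadialSystem
end LinearSystems

/-! ### Fourier coefficients on circles of a one-variable solution. -/

section CircleCoefficients

/-- The real linear map `h ↦ p h + q h̄`. -/
def wirtinger (p q : ℂ) : ℂ →L[ℝ] ℂ :=
  ContinuousLinearMap.mul ℝ ℂ p +
    (ContinuousLinearMap.mul ℝ ℂ q).comp (Complex.conjCLE : ℂ →L[ℝ] ℂ)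

@[simp]
theorem wirtinger_apply (p q h : ℂ) : wirtinger p q h = p * h + q * conj h := rfl

theorem norm_wirtinger_le (p q : ℂ) : ‖wirtinger p q‖ ≤ ‖p‖ + ‖q‖ :=
  ContinuousLinearMap.opNorm_le_bound _ (by positivity) fun h => by
    rw [wirtinger_apply, add_mul]
    refine (norm_add_le _ _).trans ?_
    simp

theorem continuous_wirtinger : Continuous fun x : ℂ × ℂ => wirtinger x.1 x.2 := by
  unfold wirtinger
  fun_prop

/-- The `m`-th Fourier coefficient of `ζ ↦ v (z ζ)`. -/
def circleCoeff (v : ℂ → ℂ) (m : ℤ) (z : ℂ) : ℂ :=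
  ∫ ζ : Circle, v (z * ζ) * (ζ : ℂ) ^ (-m) ∂circleMeasure

theorem continuous_circle_zpow (m : ℤ) : Continuous fun ζ : Circle => (ζ : ℂ) ^ m :=
  continuous_subtype_val.comp (continuous_zpow m : Continuous fun ζ : Circle => ζ ^ m)

theorem norm_circle_zpow (ζ : Circle) (m : ℤ) : ‖(ζ : ℂ) ^ m‖ = 1 := by simp [Circle.norm_coe]

theorem mul_circle_mem_ball {z : ℂ} (hz : z ∈ Metric.ball (0 : ℂ) 1) (ζ : Circle) :
    z * ζ ∈ Metric.ball (0 : ℂ) 1 := by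
  simpa [Circle.norm_coe] using hz

theorem continuous_comp_mul_circle {v : ℂ → ℂ} (hv : ContinuousOn v (Metric.ball 0 1)) {z : ℂ}
    (hz : z ∈ Metric.ball (0 : ℂ) 1) : Continuous fun ζ : Circle => v (z * ζ) :=
  hv.comp_continuous (by fun_prop) (mul_circle_mem_ball hz)

theorem integrable_circle {F : Circle → ℂ} (hF : Continuous F) : Integrable F circleMeasure :=
  hF.integrable_of_hasCompactSupport (HasCompactSupport.of_compactSpace _)

theorem circleCoeff_circle_mul (v : ℂ → ℂ) (m : ℤ) (c : Circle) (z : ℂ) :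
    circleCoeff v m (c * z) = (c : ℂ) ^ m * circleCoeff v m z := by
  have h : circleCoeff v m z
      = ∫ ζ : Circle, v (z * (c * ζ : Circle)) * ((c * ζ : Circle) : ℂ) ^ (-m) ∂circleMeasure :=
    (integral_mul_left_eq_self (fun ζ : Circle => v (z * ζ) * (ζ : ℂ) ^ (-m)) c).symm
  rw [h, circleCoeff, ← integral_const_mul]
  refine integral_congr_ae (.of_forall fun ζ => ?_)
  have hc : (c : ℂ) ≠ 0 := Circle.coe_ne_zero c
  simp only [Circle.coe_mul, mul_zpow]
  rw [show (c : ℂ) * z * ζ = z * (c * ζ) by ring, zpow_neg (c : ℂ)]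
  field_simp

/-- Differentiation under the integral. The chain rule for z ↦ zζ produces a factor ζ for ∂/∂z and
ζ̄ for ∂/∂z̄, whence the index shifts m - 1 and m + 1. -/
theorem hasFDerivAt_circleCoeff {v p q : ℂ → ℂ} (hp : ContinuousOn p (Metric.ball 0 1))
    (hq : ContinuousOn q (Metric.ball 0 1))
    (hv : ∀ z ∈ Metric.ball (0 : ℂ) 1, HasFDerivAt v (wirtinger (p z) (q z)) z) (m : ℤ) {z : ℂ}
    (hz : z ∈ Metric.ball (0 : ℂ) 1) :
    HasFDerivAt (circleCoeff v m)
      (wirtinger (circleCoeff p (m - 1) z) (circleCoeff q (m + 1) z)) z := by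
  have hz1 : ‖z‖ < 1 := by simpa using hz
  obtain ⟨ρ, hzρ, hρ1⟩ := exists_between hz1
  have hsub : Metric.closedBall (0 : ℂ) ρ ⊆ Metric.ball 0 1 := Metric.closedBall_subset_ball hρ1
  obtain ⟨P, hP⟩ := (isCompact_closedBall (0 : ℂ) ρ).exists_bound_of_continuousOn (hp.mono hsub)
  obtain ⟨Q, hQ⟩ := (isCompact_closedBall (0 : ℂ) ρ).exists_bound_of_continuousOn (hq.mono hsub)
  have hcv : ContinuousOn v (Metric.ball 0 1) :=
    fun x hx => (hv x hx).continuousAt.continuousWithinAt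
  have hnhds : Metric.closedBall (0 : ℂ) ρ ∈ 𝓝 z :=
    mem_of_superset (Metric.isOpen_ball.mem_nhds (by simpa using hzρ)) Metric.ball_subset_closedBall
  have hmem {x : ℂ} (hx : x ∈ Metric.closedBall (0 : ℂ) ρ) (ζ : Circle) :
      x * ζ ∈ Metric.closedBall (0 : ℂ) ρ := by
    simpa [Circle.norm_coe] using hx
  let F' : ℂ → Circle → ℂ →L[ℝ] ℂ := fun x ζ =>
    wirtinger (p (x * ζ) * (ζ : ℂ) ^ (-(m - 1))) (q (x * ζ) * (ζ : ℂ) ^ (-(m + 1)))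
  have hPc := (continuous_comp_mul_circle hp hz).mul (continuous_circle_zpow (-(m - 1)))
  have hQc := (continuous_comp_mul_circle hq hz).mul (continuous_circle_zpow (-(m + 1)))
  have hF'c : Continuous (F' z) := continuous_wirtinger.comp (hPc.prodMk hQc)
  have hF'i : Integrable (F' z) circleMeasure :=
    hF'c.integrable_of_hasCompactSupport (HasCompactSupport.of_compactSpace _)
  have key := hasFDerivAt_integral_of_dominated_of_fderiv_le (𝕜 := ℝ) (μ := circleMeasure)
    (F := fun x (ζ : Circle) => v (x * ζ) * (ζ : ℂ) ^ (-m)) (F' := F') (x₀ := z)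
    (bound := fun _ => P + Q) hnhds ?_ ?_ ?_ ?_ ?_ ?_
  · convert! key using 1
    ext1 h
    rw [ContinuousLinearMap.integral_apply hF'i]
    simp only [F', wirtinger_apply]
    refine Eq.trans ?_ (integral_add ((integrable_circle hPc).mul_const _)
      ((integrable_circle hQc).mul_const _)).symm
    rw [integral_mul_const, integral_mul_const]
    rfl
  · filter_upwards [hnhds] with x hx
    exact ((continuous_comp_mul_circle hcv (hsub hx)).mul
      (continuous_circle_zpow _)).aestronglyMeasurable
  · exact integrable_circle ((continuous_comp_mul_circle hcv hz).mul (continuous_circle_zpow _))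
  · exact hF'c.aestronglyMeasurable
  · refine .of_forall fun ζ x hx => (norm_wirtinger_le _ _).trans ?_
    rw [norm_mul, norm_mul, norm_circle_zpow, norm_circle_zpow, mul_one, mul_one]
    exact add_le_add (hP _ (hmem hx ζ)) (hQ _ (hmem hx ζ))
  · exact integrable_const _
  · refine .of_forall fun ζ x hx => ?_
    have hmul : HasFDerivAt (fun x : ℂ => x * (ζ : ℂ)) (wirtinger ζ 0) x := by
      convert! (hasFDerivAt_id (𝕜 := ℝ) x).mul_const (ζ : ℂ) using 1
      ext1 h
      simp [mul_comm]
    convert! ((hv _ (hsub (hmem hx ζ))).comp x hmul).mul_const ((ζ : ℂ) ^ (-m)) using 1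
    ext1 h
    have hζ : (ζ : ℂ) ≠ 0 := Circle.coe_ne_zero ζ
    simp only [F', wirtinger_apply, _root_.smul_apply, ContinuousLinearMap.comp_apply,
      smul_eq_mul, zero_mul, add_zero, map_mul]
    rw [neg_sub, sub_eq_add_neg, add_comm, zpow_add₀ hζ, neg_add m 1, zpow_add₀ hζ, zpow_one,
      zpow_neg_one, ← Circle.coe_inv, Circle.coe_inv_eq_conj]
    ring

/-- `v` solves the one variable equation `L_{a,b} v = 0` in the unit disc; `v₁`, `v₂` are its
Wirtinger derivatives, and `v₃`, `v₄` are those of `v₂`. -/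
structure IsHarmonicJet (a b : ℂ) (v v₁ v₂ v₃ v₄ : ℂ → ℂ) : Prop where
  cont₁ : ContinuousOn v₁ (Metric.ball 0 1)
  cont₃ : ContinuousOn v₃ (Metric.ball 0 1)
  cont₄ : ContinuousOn v₄ (Metric.ball 0 1)
  deriv₀ : ∀ z ∈ Metric.ball (0 : ℂ) 1, HasFDerivAt v (wirtinger (v₁ z) (v₂ z)) z
  deriv₂ : ∀ z ∈ Metric.ball (0 : ℂ) 1, HasFDerivAt v₂ (wirtinger (v₃ z) (v₄ z)) z
  eqn : ∀ z ∈ Metric.ball (0 : ℂ) 1, (1 - (‖z‖ : ℂ) ^ 2) * v₃ z + a * z * v₁ z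
    + b * conj z * v₂ z - a * b * v z = 0

theorem hasDerivAt_of_hasFDerivAt_wirtinger {F : ℂ → ℂ} {p q : ℂ} {r : ℝ}
    (h : HasFDerivAt F (wirtinger p q) r) : HasDerivAt (fun r : ℝ => F r) (p + q) r := by
  convert! HasFDerivAt.comp_hasDerivAt r h (Complex.ofRealCLM.hasDerivAt (x := r)) using 1
  simp

/-- Differentiate c(e^{it} r) = e^{imt} c(r) at t = 0. This expresses one Wirtinger derivative on
the real axis through the other. -/
theorem circleCoeff_angular {v : ℂ → ℂ} {m : ℤ} {p q : ℂ} {r : ℝ}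
    (h : HasFDerivAt (circleCoeff v m) (wirtinger p q) r) :
    r * (p - q) = m * circleCoeff v m r := by
  have hγ : HasDerivAt (fun t : ℝ => Complex.exp (t * Complex.I) * r) (Complex.I * r) 0 := by
    convert! (((Complex.ofRealCLM.hasDerivAt (x := (0 : ℝ))).mul_const Complex.I).cexp).mul_const
      (r : ℂ) using 1
    simp
  have h₁ : HasDerivAt (fun t : ℝ => circleCoeff v m (Complex.exp (t * Complex.I) * r))
      (wirtinger p q (Complex.I * r)) 0 :=
    HasFDerivAt.comp_hasDerivAt (l := circleCoeff v m)
      (f := fun t : ℝ => Complex.exp (t * Complex.I) * r) (0 : ℝ) (by simpa using h) hγ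
  have h₂ : HasDerivAt (fun t : ℝ => circleCoeff v m (Complex.exp (t * Complex.I) * r))
      (m * Complex.I * circleCoeff v m r) 0 := by
    have : (fun t : ℝ => circleCoeff v m (Complex.exp (t * Complex.I) * r))
        = fun t : ℝ => Complex.exp (m * (t * Complex.I)) * circleCoeff v m r := by
      ext t
      rw [← Circle.coe_exp, circleCoeff_circle_mul, Circle.coe_exp, ← Complex.exp_int_mul]
    rw [this]
    convert! ((((Complex.ofRealCLM.hasDerivAt (x := (0 : ℝ))).mul_const Complex.I).const_mul
      (m : ℂ)).cexp).mul_const (circleCoeff v m r) using 1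
    simp
  have h₃ := h₁.unique h₂
  simp only [wirtinger_apply, map_mul, Complex.conj_I, Complex.conj_ofReal] at h₃
  refine mul_left_cancel₀ Complex.I_ne_zero ?_
  linear_combination h₃

theorem ofReal_mem_ball {r : ℝ} (hr : r ∈ Ico (0 : ℝ) 1) :
    (r : ℂ) ∈ Metric.ball (0 : ℂ) 1 := by
  simpa [abs_of_nonneg hr.1] using hr.2

theorem integral_circle_combination {F₀ F₁ F₂ F₃ : Circle → ℂ}
    (h₀ : Integrable F₀ circleMeasure) (h₁ : Integrable F₁ circleMeasure)
    (h₂ : Integrable F₂ circleMeasure) (h₃ : Integrable F₃ circleMeasure) (c₀ c₁ c₂ c₃ : ℂ)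
    (h : ∀ ζ, c₃ * F₃ ζ + c₁ * F₁ ζ + c₂ * F₂ ζ - c₀ * F₀ ζ = 0) :
    c₃ * (∫ ζ, F₃ ζ ∂circleMeasure) + c₁ * (∫ ζ, F₁ ζ ∂circleMeasure)
      + c₂ * (∫ ζ, F₂ ζ ∂circleMeasure) - c₀ * (∫ ζ, F₀ ζ ∂circleMeasure) = 0 := by
  have e₃ := h₃.const_mul c₃
  have e₁ := h₁.const_mul c₁
  have e₂ := h₂.const_mul c₂
  have e₀ := h₀.const_mul c₀
  have e₃₁ : Integrable (fun ζ => c₃ * F₃ ζ + c₁ * F₁ ζ) circleMeasure := e₃.add e₁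
  have e₃₂ : Integrable (fun ζ => c₃ * F₃ ζ + c₁ * F₁ ζ + c₂ * F₂ ζ) circleMeasure := e₃₁.add e₂
  rw [← integral_const_mul, ← integral_const_mul, ← integral_const_mul, ← integral_const_mul,
    ← integral_add e₃ e₁, ← integral_add e₃₁ e₂, ← integral_sub e₃₂ e₀]
  exact integral_eq_zero_of_ae (.of_forall h)

theorem IsHarmonicJet.circleCoeff_eqn {a b : ℂ} {v v₁ v₂ v₃ v₄ : ℂ → ℂ}
    (h : IsHarmonicJet a b v v₁ v₂ v₃ v₄) (m : ℤ) {r : ℝ} (hr : r ∈ Ico (0 : ℝ) 1) :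
    (1 - (r : ℂ) ^ 2) * circleCoeff v₃ m r + a * r * circleCoeff v₁ (m - 1) r
      + b * r * circleCoeff v₂ (m + 1) r - a * b * circleCoeff v m r = 0 := by
  have hz := ofReal_mem_ball hr
  have hi {w : ℂ → ℂ} (hw : ContinuousOn w (Metric.ball 0 1)) (k : ℤ) :
      Integrable (fun ζ : Circle => w (r * ζ) * (ζ : ℂ) ^ (-k)) circleMeasure :=
    integrable_circle ((continuous_comp_mul_circle hw hz).mul (continuous_circle_zpow _))
  refine integral_circle_combination
    (hi (fun x hx => (h.deriv₀ x hx).continuousAt.continuousWithinAt) m) (hi h.cont₁ (m - 1))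
    (hi (fun x hx => (h.deriv₂ x hx).continuousAt.continuousWithinAt) (m + 1)) (hi h.cont₃ m)
    _ _ _ _ fun ζ => ?_
  have hζ : (ζ : ℂ) ≠ 0 := Circle.coe_ne_zero ζ
  have e := h.eqn _ (mul_circle_mem_ball hz ζ)
  rw [norm_mul, Circle.norm_coe, mul_one, Complex.norm_real, Real.norm_eq_abs,
    abs_of_nonneg hr.1, map_mul, Complex.conj_ofReal, ← Circle.coe_inv_eq_conj,
    Circle.coe_inv] at e
  rw [show -(m - 1) = -m + 1 by ring, zpow_add₀ hζ, neg_add m 1, zpow_add₀ hζ,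
    zpow_one, zpow_neg_one]
  linear_combination (ζ : ℂ) ^ (-m) * e

/-- The radial derivative is the sum p + q of the Wirtinger derivatives. The angular relations for v
and v₂ eliminate v₁ and v₄, and the differential equation eliminates v₃, leaving a closed system in
the coefficients of v and z̄v₂. -/
theorem IsHarmonicJet.radialSystem {a b : ℂ} {v v₁ v₂ v₃ v₄ : ℂ → ℂ}
    (h : IsHarmonicJet a b v v₁ v₂ v₃ v₄) (m : ℤ) :
    RadialSystem a b m (fun r => circleCoeff v m r) (fun r => r * circleCoeff v₂ (m + 1) r) := by
  have cont₂ : ContinuousOn v₂ (Metric.ball 0 1) :=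
    fun x hx => (h.deriv₂ x hx).continuousAt.continuousWithinAt
  have cont₀ : ContinuousOn v (Metric.ball 0 1) :=
    fun x hx => (h.deriv₀ x hx).continuousAt.continuousWithinAt
  have hD₀ {r : ℝ} (hr : r ∈ Ico (0 : ℝ) 1) :=
    hasFDerivAt_circleCoeff h.cont₁ cont₂ h.deriv₀ m (ofReal_mem_ball hr)
  have hD₂ {r : ℝ} (hr : r ∈ Ico (0 : ℝ) 1) :=
    hasFDerivAt_circleCoeff h.cont₃ h.cont₄ h.deriv₂ (m + 1) (ofReal_mem_ball hr)
  simp only [add_sub_cancel_right] at hD₂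
  have heq {r : ℝ} (hr : r ∈ Ico (0 : ℝ) 1) := h.circleCoeff_eqn m hr
  refine ⟨fun r hr => ?_, fun r hr => ?_, fun r hr => ?_, fun r hr => ?_, by simp⟩
  · have hr' := Ioo_subset_Ico_self hr
    have hr0 : (r : ℂ) ≠ 0 := by exact_mod_cast hr.1.ne'
    convert! hasDerivAt_of_hasFDerivAt_wirtinger (hD₀ hr') using 1
    have := circleCoeff_angular (hD₀ hr')
    field_simp
    linear_combination -this
  · have hr' := Ioo_subset_Ico_self hr
    have hr0 : (r : ℂ) ≠ 0 := by exact_mod_cast hr.1.ne'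
    have hne := one_sub_sq_ne_zero hr'
    convert! (Complex.ofRealCLM.hasDerivAt (x := r)).mul
      (hasDerivAt_of_hasFDerivAt_wirtinger (hD₂ hr')) using 1
    have e₀ := circleCoeff_angular (hD₀ hr')
    have e₂ := circleCoeff_angular (hD₂ hr')
    have e := heq hr'
    push_cast at e₂
    simp only [Complex.ofRealCLM_apply, Complex.ofReal_one]
    field_simp
    linear_combination (1 - (r : ℂ) ^ 2) * e₂ + 2 * r * a * e₀ - 2 * r * e
  · exact (hasDerivAt_of_hasFDerivAt_wirtinger (hD₀ hr)).continuousAt.continuousWithinAt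
  · exact (Complex.continuous_ofReal.continuousAt.mul
      (hasDerivAt_of_hasFDerivAt_wirtinger (hD₂ hr)).continuousAt).continuousWithinAt

end CircleCoefficients

/-! ### The one-variable Poisson kernel solves the equation. -/

section Kernel

/-- The unnormalized one variable Poisson kernel with pole at `1`. -/
def diskKernel (a b w : ℂ) : ℂ :=
  (1 - (‖w‖ : ℂ) ^ 2) ^ (a + b + 1) / ((1 - w) ^ (a + 1) * (1 - conj w) ^ (b + 1))

/-- The logarithmic derivative of `diskKernel a b` with respect to `w`. -/
def kernelLogDz (a b w : ℂ) : ℂ :=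
  (a + 1) / (1 - w) - (a + b + 1) * conj w / (1 - w * conj w)

/-- The logarithmic derivative of `diskKernel a b` with respect to `w̄`. -/
def kernelLogDzbar (a b w : ℂ) : ℂ :=
  (b + 1) / (1 - conj w) - (a + b + 1) * w / (1 - w * conj w)

theorem ofReal_norm_sq (w : ℂ) : (‖w‖ : ℂ) ^ 2 = w * conj w := by
  rw [Complex.mul_conj, Complex.normSq_eq_norm_sq]
  push_cast
  rfl

theorem one_sub_mem_slitPlane {w : ℂ} (hw : w ∈ Metric.ball (0 : ℂ) 1) :
    1 - w ∈ Complex.slitPlane := by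
  have : ‖-w‖ < 1 := by simpa using hw
  simpa [sub_eq_add_neg] using Complex.mem_slitPlane_of_norm_lt_one this

theorem conj_mem_ball {w : ℂ} (hw : w ∈ Metric.ball (0 : ℂ) 1) :
    conj w ∈ Metric.ball (0 : ℂ) 1 := by
  simpa using hw

theorem mul_conj_mem_ball {w : ℂ} (hw : w ∈ Metric.ball (0 : ℂ) 1) :
    w * conj w ∈ Metric.ball (0 : ℂ) 1 := by
  have : ‖w‖ < 1 := by simpa using hw
  simp only [mem_ball_zero_iff, norm_mul, RCLike.norm_conj]
  nlinarith [norm_nonneg w]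

theorem hasFDerivAt_mul_conj (w : ℂ) :
    HasFDerivAt (fun w : ℂ => w * conj w) (wirtinger (conj w) w) w := by
  convert! (hasFDerivAt_id (𝕜 := ℝ) w).mul
    (Complex.conjCLE : ℂ →L[ℝ] ℂ).hasFDerivAt using 1
  ext1 h
  simp [mul_comm, add_comm]

theorem hasFDerivAt_conj_wirtinger (w : ℂ) :
    HasFDerivAt (fun w : ℂ => conj w) (wirtinger 0 1) w := by
  convert! (Complex.conjCLE : ℂ →L[ℝ] ℂ).hasFDerivAt using 1
  ext1 h
  simp

theorem hasFDerivAt_id_wirtinger (w : ℂ) : HasFDerivAt (fun w : ℂ => w) (wirtinger 1 0) w := by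
  convert! hasFDerivAt_id (𝕜 := ℝ) w using 1
  ext1 h
  simp

theorem hasFDerivAt_wirtinger_mul {F G : ℂ → ℂ} {p q p' q' w : ℂ}
    (hF : HasFDerivAt F (wirtinger p q) w) (hG : HasFDerivAt G (wirtinger p' q') w) :
    HasFDerivAt (fun w => F w * G w) (wirtinger (p * G w + F w * p') (q * G w + F w * q')) w := by
  convert! hF.mul hG using 1
  ext1 h
  simp
  ring

theorem hasFDerivAt_wirtinger_comp {F G : ℂ → ℂ} {p q d w : ℂ} (hF : HasDerivAt F d (G w))
    (hG : HasFDerivAt G (wirtinger p q) w) :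
    HasFDerivAt (fun w => F (G w)) (wirtinger (d * p) (d * q)) w := by
  convert! (hF.hasFDerivAt.restrictScalars ℝ).comp w hG using 1
  ext1 h
  simp
  ring

theorem hasDerivAt_one_sub_cpow {w : ℂ} (c : ℂ) (hw : w ∈ Metric.ball (0 : ℂ) 1) :
    HasDerivAt (fun w : ℂ => (1 - w) ^ c) (-c / (1 - w) * (1 - w) ^ c) w := by
  have hs := one_sub_mem_slitPlane hw
  convert! ((hasDerivAt_id w).const_sub 1).cpow_const (c := c) hs using 1
  rw [id, Complex.cpow_sub _ _ (Complex.slitPlane_ne_zero hs), Complex.cpow_one]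
  ring

theorem diskKernel_eq (a b w : ℂ) :
    diskKernel a b w = (1 - w * conj w) ^ (a + b + 1)
      * ((1 - w) ^ (-(a + 1)) * (1 - conj w) ^ (-(b + 1))) := by
  rw [diskKernel, ofReal_norm_sq, Complex.cpow_neg, Complex.cpow_neg, ← mul_inv, div_eq_mul_inv]

/-- Derivatives are kept as the kernel times a rational logarithmic derivative, so that the equation
later reduces to an identity without powers. -/
theorem hasFDerivAt_diskKernel (a b : ℂ) {w : ℂ} (hw : w ∈ Metric.ball (0 : ℂ) 1) :
    HasFDerivAt (diskKernel a b)
      (wirtinger (diskKernel a b w * kernelLogDz a b w)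
        (diskKernel a b w * kernelLogDzbar a b w)) w := by
  have h₁ := hasFDerivAt_wirtinger_comp (G := fun w => w * conj w)
    (hasDerivAt_one_sub_cpow (a + b + 1) (mul_conj_mem_ball hw)) (hasFDerivAt_mul_conj w)
  have h₂ := hasFDerivAt_wirtinger_comp (G := fun w => w)
    (hasDerivAt_one_sub_cpow (-(a + 1)) hw) (hasFDerivAt_id_wirtinger w)
  have h₃ := hasFDerivAt_wirtinger_comp (G := fun w => conj w)
    (hasDerivAt_one_sub_cpow (-(b + 1)) (conj_mem_ball hw)) (hasFDerivAt_conj_wirtinger w)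
  have h := hasFDerivAt_wirtinger_mul h₁ (hasFDerivAt_wirtinger_mul h₂ h₃)
  have he : diskKernel a b =ᶠ[𝓝 w] fun w => (1 - w * conj w) ^ (a + b + 1)
      * ((1 - w) ^ (-(a + 1)) * (1 - conj w) ^ (-(b + 1))) := by
    exact .of_forall fun x => diskKernel_eq a b x
  refine HasFDerivAt.congr_of_eventuallyEq ?_ he
  convert! h using 2
  · rw [diskKernel_eq, kernelLogDz]
    ring
  · rw [diskKernel_eq, kernelLogDzbar]
    ring

theorem hasFDerivAt_kernelLogDzbar (a b : ℂ) {w : ℂ} (hw : w ∈ Metric.ball (0 : ℂ) 1) :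
    HasFDerivAt (kernelLogDzbar a b)
      (wirtinger (-(a + b + 1) / (1 - w * conj w) ^ 2)
        ((b + 1) / (1 - conj w) ^ 2 - (a + b + 1) * w ^ 2 / (1 - w * conj w) ^ 2)) w := by
  have hinv {x : ℂ} (hx : x ∈ Metric.ball (0 : ℂ) 1) :
      HasDerivAt (fun x : ℂ => (1 - x)⁻¹) (1 / (1 - x) ^ 2) x := by
    convert! ((hasDerivAt_id x).const_sub 1).inv
      (Complex.slitPlane_ne_zero (one_sub_mem_slitPlane hx)) using 1
    simp
  have hc (c : ℂ) : HasFDerivAt (fun _ : ℂ => c) (wirtinger 0 0) w := by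
    convert! hasFDerivAt_const (𝕜 := ℝ) c w using 1
    ext1 h
    simp
  have h₁ := hasFDerivAt_wirtinger_mul (hc (b + 1))
    (hasFDerivAt_wirtinger_comp (G := fun w => conj w) (hinv (conj_mem_ball hw)) (hasFDerivAt_conj_wirtinger w))
  have h₂ := hasFDerivAt_wirtinger_mul (hc (a + b + 1)) (hasFDerivAt_wirtinger_mul
    (hasFDerivAt_id_wirtinger w)
    (hasFDerivAt_wirtinger_comp (G := fun w => w * conj w) (hinv (mul_conj_mem_ball hw)) (hasFDerivAt_mul_conj w)))
  have hne := Complex.slitPlane_ne_zero (one_sub_mem_slitPlane (mul_conj_mem_ball hw))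
  have hne' := Complex.slitPlane_ne_zero (one_sub_mem_slitPlane (conj_mem_ball hw))
  convert! h₁.sub h₂ using 1
  · ext x
    simp only [kernelLogDzbar, Pi.sub_apply]
    ring
  · ext1 h
    simp only [wirtinger_apply, _root_.sub_apply]
    field_simp
    ring

theorem continuousOn_diskKernel (a b : ℂ) : ContinuousOn (diskKernel a b) (Metric.ball 0 1) :=
  fun _ hw => (hasFDerivAt_diskKernel a b hw).continuousAt.continuousWithinAt

theorem continuousOn_kernelLogDz (a b : ℂ) : ContinuousOn (kernelLogDz a b) (Metric.ball 0 1) := by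
  have h₁ : ∀ w ∈ Metric.ball (0 : ℂ) 1, 1 - w ≠ 0 := fun w hw =>
    Complex.slitPlane_ne_zero (one_sub_mem_slitPlane hw)
  have h₂ : ∀ w ∈ Metric.ball (0 : ℂ) 1, 1 - w * conj w ≠ 0 := fun w hw =>
    Complex.slitPlane_ne_zero (one_sub_mem_slitPlane (mul_conj_mem_ball hw))
  have hconj : Continuous fun w : ℂ => conj w := Complex.continuous_conj
  exact ((continuousOn_const).div (by fun_prop) h₁).sub
    (ContinuousOn.div (by fun_prop) (by fun_prop) h₂)

theorem isHarmonicJet_diskKernel (a b : ℂ) :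
    IsHarmonicJet a b (diskKernel a b) (fun w => diskKernel a b w * kernelLogDz a b w)
      (fun w => diskKernel a b w * kernelLogDzbar a b w)
      (fun w => diskKernel a b w * (kernelLogDz a b w * kernelLogDzbar a b w
        + -(a + b + 1) / (1 - w * conj w) ^ 2))
      (fun w => diskKernel a b w * (kernelLogDzbar a b w * kernelLogDzbar a b w
        + ((b + 1) / (1 - conj w) ^ 2 - (a + b + 1) * w ^ 2 / (1 - w * conj w) ^ 2))) where
  cont₁ := (continuousOn_diskKernel a b).mul (continuousOn_kernelLogDz a b)
  cont₃ := by
    have hconj : Continuous fun w : ℂ => conj w := Complex.continuous_conj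
    have hB : ContinuousOn (kernelLogDzbar a b) (Metric.ball 0 1) :=
      fun _ hw => (hasFDerivAt_kernelLogDzbar a b hw).continuousAt.continuousWithinAt
    refine (continuousOn_diskKernel a b).mul (((continuousOn_kernelLogDz a b).mul hB).add
      (ContinuousOn.div (by fun_prop) (by fun_prop) fun w hw => pow_ne_zero 2
        (Complex.slitPlane_ne_zero (one_sub_mem_slitPlane (mul_conj_mem_ball hw)))))
  cont₄ := by
    have hconj : Continuous fun w : ℂ => conj w := Complex.continuous_conj
    have hB : ContinuousOn (kernelLogDzbar a b) (Metric.ball 0 1) :=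
      fun _ hw => (hasFDerivAt_kernelLogDzbar a b hw).continuousAt.continuousWithinAt
    refine (continuousOn_diskKernel a b).mul ((hB.mul hB).add
      ((ContinuousOn.div (by fun_prop) (by fun_prop) fun w hw => pow_ne_zero 2
        (Complex.slitPlane_ne_zero (one_sub_mem_slitPlane (conj_mem_ball hw)))).sub
      (ContinuousOn.div (by fun_prop) (by fun_prop) fun w hw => pow_ne_zero 2
        (Complex.slitPlane_ne_zero (one_sub_mem_slitPlane (mul_conj_mem_ball hw))))))
  deriv₀ w hw := hasFDerivAt_diskKernel a b hw
  deriv₂ w hw := by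
    convert! hasFDerivAt_wirtinger_mul (hasFDerivAt_diskKernel a b hw)
      (hasFDerivAt_kernelLogDzbar a b hw) using 2 <;> ring
  eqn w hw := by
    have h₁ := Complex.slitPlane_ne_zero (one_sub_mem_slitPlane hw)
    have h₂ := Complex.slitPlane_ne_zero (one_sub_mem_slitPlane (conj_mem_ball hw))
    have h₃ := Complex.slitPlane_ne_zero (one_sub_mem_slitPlane (mul_conj_mem_ball hw))
    rw [ofReal_norm_sq, kernelLogDz, kernelLogDzbar]
    -- After factoring out the kernel, the equation is a rational identity valid with w and w̄ as
    -- independent variables.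
    generalize conj w = y at *
    field_simp
    ring

end Kernel

/-! ### Binomial coefficients, Gamma asymptotics and an Abelian theorem. -/

section BinomialSeries

/-- The Taylor coefficients of `(1 - z) ^ (-a)`. -/
def risingCoeff (a : ℂ) (k : ℕ) : ℂ := (∏ j ∈ Finset.range k, (a + j)) / (k.factorial : ℂ)

theorem risingCoeff_eq_choose (a : ℂ) (k : ℕ) : risingCoeff a k = Ring.choose (a + k - 1) k := by
  have h₁ : (ascPochhammer ℂ k).eval a = ∏ j ∈ Finset.range k, (a + j) := by
    induction k with
    | zero => simp
    | succ k ih => rw [ascPochhammer_succ_eval, ih, Finset.prod_range_succ]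
  have h₂ := Ring.factorial_nsmul_multichoose_eq_ascPochhammer a k
  rw [Polynomial.ascPochhammer_smeval_eq_eval, h₁, Ring.multichoose_eq, nsmul_eq_mul] at h₂
  have : (k.factorial : ℂ) ≠ 0 := by exact_mod_cast k.factorial_ne_zero
  rw [risingCoeff, ← h₂]
  field_simp

theorem hasSum_risingCoeff (a : ℂ) {z : ℂ} (hz : z ∈ Metric.ball (0 : ℂ) 1) :
    HasSum (fun k => risingCoeff a k * z ^ k) ((1 - z) ^ (-a)) := by
  have h := (Complex.one_div_one_sub_cpow_hasFPowerSeriesOnBall_zero a).hasSum (y := z)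
    (by simpa [Metric.mem_eball, edist_zero_right, ← ofReal_norm] using hz)
  simpa [FormalMultilinearSeries.ofScalars_apply_eq, risingCoeff_eq_choose, Complex.cpow_neg,
    smul_eq_mul, mul_comm] using h

theorem summable_norm_risingCoeff (a : ℂ) {r : ℝ} (hr : r ∈ Ico (0 : ℝ) 1) :
    Summable fun k => ‖risingCoeff a k‖ * r ^ k := by
  have h := (hasSum_risingCoeff a (ofReal_mem_ball hr)).summable.norm
  simpa [abs_of_nonneg hr.1] using h

theorem risingCoeff_ne_zero {a : ℂ} (ha : ∀ k : ℕ, a ≠ -k) (k : ℕ) : risingCoeff a k ≠ 0 := by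
  refine div_ne_zero (Finset.prod_ne_zero_iff.mpr fun j _ => ?_)
    (by exact_mod_cast k.factorial_ne_zero)
  exact fun h => ha j (eq_neg_of_add_eq_zero_left h)

/-- Links the Taylor coefficients to Euler's product for Γ, and so gives their asymptotics
n^(a-1)/Γ(a). -/
theorem risingCoeff_succ_eq (a : ℂ) (n : ℕ) (hn : n ≠ 0) :
    risingCoeff a (n + 1) = (n : ℂ) ^ a / ((n + 1) * Complex.GammaSeq a n) := by
  have hna : (n : ℂ) ^ a ≠ 0 := by simp [Complex.cpow_eq_zero_iff, hn]
  have hf : (n.factorial : ℂ) ≠ 0 := by exact_mod_cast n.factorial_ne_zero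
  have hn1 : (n : ℂ) + 1 ≠ 0 := by exact_mod_cast n.succ_ne_zero
  rw [risingCoeff, Complex.GammaSeq, Nat.factorial_succ]
  push_cast
  field_simp

theorem ne_neg_natCast_of_re_pos {s : ℂ} (hs : 0 < s.re) (k : ℕ) : s ≠ -k := by
  rintro rfl
  simp at hs
  linarith [k.cast_nonneg (α := ℝ)]

theorem tendsto_natCast_div_succ : Tendsto (fun n : ℕ => (n : ℂ) / (n + 1)) atTop (𝓝 1) :=
  tendsto_natCast_div_add_atTop 1

/-- Shifting the index does not change the asymptotics of the binomial coefficients. -/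
theorem tendsto_risingCoeff_shift {a : ℂ} (ha : ∀ k : ℕ, a ≠ -k) (m : ℕ) :
    Tendsto (fun k => risingCoeff a (k + m) / risingCoeff a k) atTop (𝓝 1) := by
  have hstep : Tendsto (fun k : ℕ => (a + k) / (k + 1)) atTop (𝓝 1) := by
    have h₁ : Tendsto (fun k : ℕ => a / ((k : ℂ) + 1)) atTop (𝓝 0) :=
      (tendsto_const_div_atTop_nhds_zero_nat a).comp (tendsto_add_atTop_nat 1) |>.congr fun k => by
        simp
    simpa [add_div] using h₁.add tendsto_natCast_div_succ
  have hsucc (k : ℕ) : risingCoeff a (k + 1) / risingCoeff a k = (a + k) / (k + 1) := by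
    have hf : (k.factorial : ℂ) ≠ 0 := by exact_mod_cast k.factorial_ne_zero
    have hk1 : (k : ℂ) + 1 ≠ 0 := by exact_mod_cast k.succ_ne_zero
    rw [div_eq_iff (risingCoeff_ne_zero ha k), risingCoeff, risingCoeff, Finset.prod_range_succ,
      Nat.factorial_succ]
    push_cast
    field_simp
  induction m with
  | zero => exact tendsto_const_nhds.congr fun k => (div_self (risingCoeff_ne_zero ha k)).symm
  | succ m ih =>
    have h := (hstep.comp (tendsto_add_atTop_nat m)).mul ih
    rw [mul_one] at h
    refine h.congr fun k => ?_
    rw [Function.comp_apply, ← hsucc, ← add_assoc,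
      div_mul_div_cancel₀ (risingCoeff_ne_zero ha (k + m))]

/-- The powers of n nearly cancel, n^a n^b / n^(a+b-1) = n, and the index shift by one supplies the
compensating 1/(n+1); only the Gamma factors survive. -/
theorem tendsto_risingCoeff_ratio {a b : ℂ} (ha : ∀ k : ℕ, a ≠ -k) (hb : ∀ k : ℕ, b ≠ -k)
    (hs : 0 < (a + b - 1).re) (m : ℕ) :
    Tendsto (fun k => risingCoeff a (k + m) * risingCoeff b k / risingCoeff (a + b - 1) k) atTop
      (𝓝 (Complex.Gamma (a + b - 1) / (Complex.Gamma a * Complex.Gamma b))) := by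
  have hs' := ne_neg_natCast_of_re_pos hs
  have hG := (tendsto_natCast_div_succ.mul ((Complex.GammaSeq_tendsto_Gamma (a + b - 1)).div
    ((Complex.GammaSeq_tendsto_Gamma a).mul (Complex.GammaSeq_tendsto_Gamma b))
    (mul_ne_zero (Complex.Gamma_ne_zero ha) (Complex.Gamma_ne_zero hb))))
  have h₀ : Tendsto (fun k => risingCoeff a k * risingCoeff b k / risingCoeff (a + b - 1) k) atTop
      (𝓝 (Complex.Gamma (a + b - 1) / (Complex.Gamma a * Complex.Gamma b))) := by
    rw [← tendsto_add_atTop_iff_nat 1]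
    rw [one_mul] at hG
    refine hG.congr' ?_
    filter_upwards [eventually_ne_atTop 0] with n hn
    have hn0 : (n : ℂ) ≠ 0 := by exact_mod_cast hn
    have hn1 : (n : ℂ) + 1 ≠ 0 := by exact_mod_cast n.succ_ne_zero
    rw [risingCoeff_succ_eq a n hn, risingCoeff_succ_eq b n hn, risingCoeff_succ_eq _ n hn,
      Complex.cpow_sub _ _ hn0, Complex.cpow_add _ _ hn0, Complex.cpow_one]
    have hna : (n : ℂ) ^ a ≠ 0 := by simp [Complex.cpow_eq_zero_iff, hn]
    have hnb : (n : ℂ) ^ b ≠ 0 := by simp [Complex.cpow_eq_zero_iff, hn]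
    simp only [Pi.div_apply]
    field_simp
  have h := (tendsto_risingCoeff_shift ha m).mul h₀
  rw [one_mul] at h
  refine h.congr fun k => ?_
  have := risingCoeff_ne_zero ha k
  field_simp

theorem risingCoeff_ofReal {σ : ℝ} (hσ : 0 < σ) (k : ℕ) :
    risingCoeff σ k = (‖risingCoeff σ k‖ : ℂ) := by
  have h : risingCoeff σ k = (((∏ j ∈ Finset.range k, (σ + j)) / (k.factorial : ℝ) : ℝ) : ℂ) := by
    simp [risingCoeff]
  rw [h, Complex.norm_real, Real.norm_of_nonneg]
  positivity

theorem hasSum_norm_risingCoeff {σ : ℝ} (hσ : 0 < σ) {x : ℝ} (hx : x ∈ Ico (0 : ℝ) 1) :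
    HasSum (fun k => ‖risingCoeff σ k‖ * x ^ k) ((1 - x) ^ (-σ)) := by
  have h := hasSum_risingCoeff σ (ofReal_mem_ball hx)
  rw [← Complex.hasSum_ofReal, Complex.ofReal_cpow (by linarith [hx.2])]
  push_cast
  refine h.congr_fun fun k => ?_
  rw [← risingCoeff_ofReal hσ]

/-- Since |n^s| = n^(Re s), the quotient of norms converges and is bounded. The majorant has
positive coefficients with the explicit sum (1-x)^(-Re s), which no longer holds for the norms at
complex s. -/
theorem exists_norm_risingCoeff_le {s : ℂ} (hs : 0 < s.re) :
    ∃ C, ∀ k, ‖risingCoeff s k‖ ≤ C * ‖risingCoeff (s.re : ℂ) k‖ := by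
  have hs' := ne_neg_natCast_of_re_pos hs
  have hσ' := ne_neg_natCast_of_re_pos (s := (s.re : ℂ)) (by simpa using hs)
  have hG := ((Complex.GammaSeq_tendsto_Gamma (s.re : ℂ)).div (Complex.GammaSeq_tendsto_Gamma s)
    (Complex.Gamma_ne_zero hs')).norm
  have h : Tendsto (fun k => ‖risingCoeff s k‖ / ‖risingCoeff (s.re : ℂ) k‖) atTop
      (𝓝 ‖Complex.Gamma (s.re : ℂ) / Complex.Gamma s‖) := by
    rw [← tendsto_add_atTop_iff_nat 1]
    refine hG.congr' ?_
    filter_upwards [eventually_ne_atTop 0] with n hn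
    have hn1 : ‖(n : ℂ) + 1‖ ≠ 0 := by
      rw [norm_ne_zero_iff]; exact_mod_cast n.succ_ne_zero
    have hnn : ‖(n : ℂ) ^ s‖ = ‖(n : ℂ) ^ (s.re : ℂ)‖ := by
      rw [Complex.norm_natCast_cpow_of_pos (Nat.pos_of_ne_zero hn),
        Complex.norm_natCast_cpow_of_pos (Nat.pos_of_ne_zero hn), Complex.ofReal_re]
    have hna : ‖(n : ℂ) ^ (s.re : ℂ)‖ ≠ 0 := by
      rw [norm_ne_zero_iff, Ne, Complex.cpow_eq_zero_iff]
      simp [hn]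
    rw [risingCoeff_succ_eq s n hn, risingCoeff_succ_eq _ n hn]
    simp only [Pi.div_apply, norm_div, norm_mul, hnn]
    field_simp
  obtain ⟨C, hC⟩ := h.bddAbove_range
  refine ⟨C, fun k => ?_⟩
  rw [← div_le_iff₀ (norm_pos_iff.mpr (risingCoeff_ne_zero hσ' k))]
  exact hC ⟨k, rfl⟩

/-- An Abelian theorem for power series whose coefficients are asymptotic to those of
`(1 - x) ^ (-s)`. -/
theorem tendsto_one_sub_cpow_mul_tsum {t : ℕ → ℂ} {q s : ℂ} (hs : 0 < s.re)
    (ht : Tendsto (fun k => t k / risingCoeff s k) atTop (𝓝 q)) :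
    Tendsto (fun x : ℝ => (1 - (x : ℂ)) ^ s * ∑' k, t k * (x : ℂ) ^ k) (𝓝[<] 1) (𝓝 q) := by
  have hs' := ne_neg_natCast_of_re_pos hs
  obtain ⟨C, hC⟩ := exists_norm_risingCoeff_le hs
  set R : ℕ → ℝ := fun k => ‖risingCoeff (s.re : ℂ) k‖
  have hR0 (k : ℕ) : 0 ≤ R k := norm_nonneg _
  have hC0 : 0 ≤ C := by
    by_contra hneg
    have h0 := hC 0
    have h1 : ‖risingCoeff s 0‖ = 1 := by simp [risingCoeff]
    have h2 : ‖risingCoeff (s.re : ℂ) 0‖ = 1 := by simp [risingCoeff]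
    rw [h1, h2] at h0
    linarith
  have hsmall {ε : ℝ} (hε : 0 < ε) : ∃ N, ∀ k ≥ N, ‖t k - q * risingCoeff s k‖ ≤ ε * R k := by
    -- Passing from s to its real part costs a factor C; dividing by C + 1 absorbs it, even for C =
    -- 0.
    have hev := (Metric.tendsto_nhds.mp ht) (ε / (C + 1)) (by positivity)
    obtain ⟨N, hN⟩ := eventually_atTop.mp hev
    refine ⟨N, fun k hk => ?_⟩
    have h := (hN k hk).le
    have hne := risingCoeff_ne_zero hs' k
    rw [dist_eq_norm, show t k / risingCoeff s k - q
      = (t k - q * risingCoeff s k) / risingCoeff s k by field_simp, norm_div,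
      div_le_iff₀ (norm_pos_iff.mpr hne)] at h
    refine h.trans ?_
    calc ε / (C + 1) * ‖risingCoeff s k‖ ≤ ε / (C + 1) * (C * R k) := by
          gcongr
          exact hC k
      _ = ε * R k * (C / (C + 1)) := by ring
      _ ≤ ε * R k * 1 := by
          gcongr
          rw [div_le_one (by positivity)]
          linarith
      _ = ε * R k := mul_one _
  have hmain {ε : ℝ} (hε : 0 < ε) : ∃ A : ℝ, ∀ x ∈ Ico (0 : ℝ) 1,
      ‖(1 - (x : ℂ)) ^ s * ∑' k, t k * (x : ℂ) ^ k - q‖ ≤ A * (1 - x) ^ s.re + ε := by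
    obtain ⟨N, hN⟩ := hsmall hε
    -- The finitely many uncontrolled errors contribute a constant, which (1-x)^(Re s) kills at x =
    -- 1; the tail contributes at most ε.
    let e : ℕ → ℝ := fun k => if k < N then ‖t k - q * risingCoeff s k‖ else 0
    have he0 (k : ℕ) : 0 ≤ e k := by
      simp only [e]; split_ifs <;> positivity
    have hbound (k : ℕ) : ‖t k - q * risingCoeff s k‖ ≤ e k + ε * R k := by
      by_cases hk : k < N
      · simp only [e, hk, if_true]
        have := hR0 k
        nlinarith [mul_nonneg hε.le this]
      · simpa [e, hk] using hN k (not_lt.mp hk)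
    refine ⟨∑ k ∈ Finset.range N, e k, fun x hx => ?_⟩
    have hsumR := hasSum_norm_risingCoeff hs hx
    have hsume : HasSum e (∑ k ∈ Finset.range N, e k) :=
      hasSum_sum_of_ne_finset_zero fun k hk => by
        simp only [Finset.mem_range] at hk
        simp [e, hk]
    have hle (k : ℕ) : ‖(t k - q * risingCoeff s k) * (x : ℂ) ^ k‖
        ≤ e k + ε * (R k * x ^ k) := by
      rw [norm_mul, norm_pow, Complex.norm_real, Real.norm_of_nonneg hx.1]
      have h1 : x ^ k ≤ 1 := pow_le_one₀ hx.1 hx.2.le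
      have h2 : 0 ≤ x ^ k := pow_nonneg hx.1 k
      calc _ ≤ (e k + ε * R k) * x ^ k := by gcongr; exact hbound k
        _ = e k * x ^ k + ε * (R k * x ^ k) := by ring
        _ ≤ _ := by
          gcongr
          exact mul_le_of_le_one_right (he0 k) h1
    have hsumb := hsume.add (hsumR.mul_left ε)
    have hsumE : Summable fun k => (t k - q * risingCoeff s k) * (x : ℂ) ^ k :=
      Summable.of_norm_bounded hsumb.summable hle
    have hnorm : ‖∑' k, (t k - q * risingCoeff s k) * (x : ℂ) ^ k‖
        ≤ ∑ k ∈ Finset.range N, e k + ε * (1 - x) ^ (-s.re) :=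
      tsum_of_norm_bounded hsumb hle
    have hsums := hasSum_risingCoeff s (ofReal_mem_ball hx)
    have hx1 : 0 < 1 - x := by linarith [hx.2]
    have hx1' : (1 - (x : ℂ)) ≠ 0 := by exact_mod_cast hx1.ne'
    have htsum : ∑' k, t k * (x : ℂ) ^ k
        = ∑' k, (t k - q * risingCoeff s k) * (x : ℂ) ^ k + q * (1 - (x : ℂ)) ^ (-s) := by
      rw [← hsums.tsum_eq, ← tsum_mul_left, ← hsumE.tsum_add (hsums.summable.mul_left q)]
      exact tsum_congr fun k => by ring
    rw [htsum, mul_add, mul_left_comm, ← Complex.cpow_add _ _ hx1', add_neg_cancel,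
      Complex.cpow_zero, mul_one, add_sub_cancel_right, norm_mul]
    have hnx : ‖(1 - (x : ℂ)) ^ s‖ = (1 - x) ^ s.re := by
      rw [← Complex.norm_cpow_eq_rpow_re_of_pos hx1]
      push_cast
      rfl
    rw [hnx]
    have hp : 0 ≤ (1 - x) ^ s.re := by positivity
    calc _ ≤ (1 - x) ^ s.re * (∑ k ∈ Finset.range N, e k + ε * (1 - x) ^ (-s.re)) := by gcongr
      _ = (∑ k ∈ Finset.range N, e k) * (1 - x) ^ s.re
          + ε * ((1 - x) ^ s.re * (1 - x) ^ (-s.re)) := by ring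
      _ = _ := by rw [← Real.rpow_add hx1, add_neg_cancel, Real.rpow_zero, mul_one]
  rw [Metric.tendsto_nhds]
  intro ε hε
  obtain ⟨A, hA⟩ := hmain (half_pos hε)
  have hlim : Tendsto (fun x : ℝ => A * (1 - x) ^ s.re + ε / 2) (𝓝[<] 1) (𝓝 (ε / 2)) := by
    have h1 : Tendsto (fun x : ℝ => 1 - x) (𝓝[<] 1) (𝓝 0) := by
      have : Tendsto (fun x : ℝ => 1 - x) (𝓝 1) (𝓝 (1 - 1)) := by
        exact (continuous_const.sub continuous_id).tendsto _
      rw [sub_self] at this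
      exact this.mono_left nhdsWithin_le_nhds
    have h2 := h1.rpow_const (p := s.re) (Or.inr hs.le)
    rw [Real.zero_rpow hs.ne'] at h2
    simpa using (h2.const_mul A).add_const (ε / 2)
  filter_upwards [hlim.eventually_lt_const (half_lt_self hε), Ioo_mem_nhdsLT one_pos] with x hx hx'
  rw [dist_eq_norm]
  exact (hA x (Ioo_subset_Ico_self hx')).trans_lt hx

end BinomialSeries

/-! ### Fourier coefficients of the kernel and their boundary limit. -/

section KernelCoefficients

/-- Multiply the binomial series of the two factors and integrate termwise: orthogonality keeps only
the index pairs (k + m, k). -/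
theorem hasSum_circleCoeff_diskKernel (a b : ℂ) (m : ℕ) {r : ℝ} (hr : r ∈ Ico (0 : ℝ) 1) :
    HasSum (fun k => (1 - (r : ℂ) ^ 2) ^ (a + b + 1) *
      ((r : ℂ) ^ m * (risingCoeff (a + 1) (k + m) * risingCoeff (b + 1) k * ((r ^ 2 : ℝ) : ℂ) ^ k)))
      (circleCoeff (diskKernel a b) m r) := by
  have hball := ofReal_mem_ball hr
  let A : ℕ → ℂ := fun k => risingCoeff (a + 1) k * (r : ℂ) ^ k
  let B : ℕ → ℂ := fun k => risingCoeff (b + 1) k * (r : ℂ) ^ k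
  have hAB {c : ℂ} : Summable fun k => ‖risingCoeff c k * (r : ℂ) ^ k‖ := by
    simpa [abs_of_nonneg hr.1] using summable_norm_risingCoeff c hr
  let F : ℕ × ℕ → Circle → ℂ := fun p ζ =>
    (1 - (r : ℂ) ^ 2) ^ (a + b + 1) * (A p.1 * B p.2 * (ζ : ℂ) ^ ((p.1 : ℤ) - p.2 - m))
  have hFc (p : ℕ × ℕ) : Continuous (F p) :=
    continuous_const.mul (continuous_const.mul (continuous_circle_zpow _))
  have hFn (p : ℕ × ℕ) (ζ : Circle) :
      ‖F p ζ‖ = ‖(1 - (r : ℂ) ^ 2) ^ (a + b + 1)‖ * (‖A p.1‖ * ‖B p.2‖) := by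
    simp only [F, norm_mul, norm_circle_zpow, mul_one]
  have hsum : Summable fun p : ℕ × ℕ => ∫ ζ, ‖F p ζ‖ ∂circleMeasure := by
    simp only [hFn, integral_const, probReal_univ, one_smul]
    exact (hAB.mul_of_nonneg hAB (fun _ => norm_nonneg _) fun _ => norm_nonneg _).mul_left _
  have hpt (ζ : Circle) : HasSum (fun p => F p ζ)
      (diskKernel a b (r * ζ) * (ζ : ℂ) ^ (-(m : ℤ))) := by
    have hζ : (ζ : ℂ) ≠ 0 := Circle.coe_ne_zero ζ
    have hz := mul_circle_mem_ball hball ζ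
    have h₁ := hasSum_risingCoeff (a + 1) hz
    have h₂ := hasSum_risingCoeff (b + 1) (conj_mem_ball hz)
    have h₃ := ((h₁.mul h₂ (h₁.summable.norm.mul_norm h₂.summable.norm).of_norm).mul_left
      ((1 - (r : ℂ) ^ 2) ^ (a + b + 1))).mul_right ((ζ : ℂ) ^ (-(m : ℤ)))
    rw [diskKernel_eq, ← ofReal_norm_sq, norm_mul, Circle.norm_coe, mul_one, Complex.norm_real,
      Real.norm_of_nonneg hr.1]
    convert! h₃ using 1
    ext p
    simp only [F, A, B]
    rw [map_mul, Complex.conj_ofReal, ← Circle.coe_inv_eq_conj, Circle.coe_inv, mul_pow, mul_pow,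
      show (p.1 : ℤ) - p.2 - m = p.1 + -p.2 + -m by ring, zpow_add₀ hζ, zpow_add₀ hζ,
      zpow_natCast, inv_pow, zpow_neg (ζ : ℂ) (p.2 : ℤ), zpow_natCast]
    ring
  have hint := hasSum_integral_of_summable_integral_norm (μ := circleMeasure)
    (fun p => integrable_circle (hFc p)) hsum
  have hval : ∫ ζ, ∑' p, F p ζ ∂circleMeasure = circleCoeff (diskKernel a b) m r :=
    integral_congr_ae (.of_forall fun ζ => (hpt ζ).tsum_eq)
  rw [hval] at hint
  let g : ℕ → ℕ × ℕ := fun k => (k + m, k)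
  have hg : Function.Injective g := fun x y h => (Prod.mk.inj h).2
  have hF0 (p : ℕ × ℕ) : ∫ ζ, F p ζ ∂circleMeasure
      = (1 - (r : ℂ) ^ 2) ^ (a + b + 1) * (A p.1 * B p.2 * if (p.1 : ℤ) - p.2 - m = 0 then 1 else 0) := by
    simp only [F]
    rw [integral_const_mul, integral_const_mul, integral_circle_zpow]
  rw [← hg.hasSum_iff] at hint
  · convert! hint using 1
    ext k
    rw [Function.comp_apply, hF0, if_pos (by simp [g])]
    simp only [A, B, g]
    push_cast
    ring
  · intro p hp
    rw [hF0, if_neg, mul_zero, mul_zero]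
    intro h0
    exact hp ⟨p.2, Prod.ext (by simp only [g]; omega) rfl⟩

/-- The substitution ζ ↦ ζ⁻¹ = ζ̄ swaps the two factors of the kernel. It reduces negative
frequencies to nonnegative ones. -/
theorem circleCoeff_diskKernel_neg (a b : ℂ) (m : ℤ) (r : ℝ) :
    circleCoeff (diskKernel a b) (-m) r = circleCoeff (diskKernel b a) m r := by
  have h := integral_inv_eq_self
    (fun ζ : Circle => diskKernel a b (r * ζ) * (ζ : ℂ) ^ (-(-m))) circleMeasure
  rw [circleCoeff, ← h]
  refine integral_congr_ae (.of_forall fun ζ => ?_)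
  simp only [diskKernel, Circle.coe_inv_eq_conj, map_mul, Complex.conj_ofReal, Complex.conj_conj,
    norm_mul, RCLike.norm_conj]
  rw [← Circle.coe_inv_eq_conj, Circle.coe_inv, inv_zpow', neg_neg, add_comm a b,
    mul_comm ((1 - (r : ℂ) * (ζ : ℂ)⁻¹) ^ (a + 1))]

/-- The Fourier coefficients of the normalized Poisson kernel tend to `1` at the boundary. -/
theorem tendsto_coef_mul_circleCoeff_diskKernel {a b : ℂ} (hre : -1 < a.re + b.re)
    (ha : ∀ k : ℕ, a ≠ -((k : ℂ) + 1)) (hb : ∀ k : ℕ, b ≠ -((k : ℂ) + 1)) (m : ℤ) :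
    Tendsto (fun r : ℝ => coef a b * circleCoeff (diskKernel a b) m r) (𝓝[<] 1) (𝓝 1) := by
  wlog hm : 0 ≤ m generalizing a b m
  · have h := this (a := b) (b := a) (by linarith) hb ha (-m) (by omega)
    refine h.congr fun r => ?_
    rw [← circleCoeff_diskKernel_neg a b (-m) r, neg_neg, coef, coef, add_comm b a,
      mul_comm (Complex.Gamma (b + 1))]
  lift m to ℕ using hm
  have ha' (k : ℕ) : a + 1 ≠ -k := fun h => ha k (by linear_combination h)
  have hb' (k : ℕ) : b + 1 ≠ -k := fun h => hb k (by linear_combination h)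
  have hab : a + 1 + (b + 1) - 1 = a + b + 1 := by ring
  have hs : 0 < (a + b + 1).re := by simp; linarith
  have hq := tendsto_risingCoeff_ratio ha' hb' (by rw [hab]; exact hs) m
  rw [hab] at hq
  have habel := tendsto_one_sub_cpow_mul_tsum hs hq
  -- The series is a power series in r², so the Abelian theorem is used at x = r².
  have hsq : Tendsto (fun r : ℝ => r ^ 2) (𝓝[<] 1) (𝓝[<] 1) := by
    refine tendsto_nhdsWithin_iff.mpr ⟨?_, ?_⟩
    · have : Tendsto (fun r : ℝ => r ^ 2) (𝓝 1) (𝓝 (1 ^ 2)) := (continuous_pow 2).tendsto _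
      rw [one_pow] at this
      exact this.mono_left nhdsWithin_le_nhds
    · filter_upwards [Ioo_mem_nhdsLT one_pos] with r hr
      simp only [mem_Iio]
      nlinarith [hr.1, hr.2]
  have hpow : Tendsto (fun r : ℝ => (r : ℂ) ^ m) (𝓝[<] 1) (𝓝 1) := by
    have : Tendsto (fun r : ℝ => (r : ℂ) ^ m) (𝓝 1) (𝓝 (((1 : ℝ) : ℂ) ^ m)) :=
      (Complex.continuous_ofReal.pow m).tendsto _
    simp only [Complex.ofReal_one, one_pow] at this
    exact this.mono_left nhdsWithin_le_nhds
  have h := (hpow.mul (habel.comp hsq)).const_mul (coef a b)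
  have hlim : coef a b * (1 * (Complex.Gamma (a + b + 1)
      / (Complex.Gamma (a + 1) * Complex.Gamma (b + 1)))) = 1 := by
    have h₁ := Complex.Gamma_ne_zero ha'
    have h₂ := Complex.Gamma_ne_zero hb'
    have h₃ := Complex.Gamma_ne_zero (ne_neg_natCast_of_re_pos hs)
    rw [coef]
    field_simp
  rw [hlim] at h
  refine h.congr' ?_
  filter_upwards [Ioo_mem_nhdsLT one_pos] with r hr
  rw [← (hasSum_circleCoeff_diskKernel a b m (Ioo_subset_Ico_self hr)).tsum_eq, tsum_mul_left,
    tsum_mul_left, Function.comp_apply]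
  push_cast
  ring

end KernelCoefficients

/-! ### One-variable slices of separately harmonic functions. -/

section Slices

variable {n : ℕ}

theorem isOpen_polydisc : IsOpen (polydisc n) := by
  have : polydisc n = ⋂ j, {z : Fin n → ℂ | ‖z j‖ < 1} := by ext; simp [polydisc]
  rw [this]
  exact isOpen_iInter_of_finite fun j => isOpen_lt (by fun_prop) continuous_const

theorem update_mem_polydisc {z : Fin n → ℂ} (hz : z ∈ polydisc n) (j : Fin n) {w : ℂ}
    (hw : w ∈ Metric.ball (0 : ℂ) 1) : Function.update z j w ∈ polydisc n := by
  intro i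
  by_cases h : i = j
  · subst h
    simpa using hw
  · simpa [h] using hz i

theorem hasFDerivAt_slice {F : (Fin n → ℂ) → ℂ} {z : Fin n → ℂ} {j : Fin n} {w : ℂ}
    (hF : DifferentiableAt ℝ F (Function.update z j w)) :
    HasFDerivAt (fun w => F (Function.update z j w))
      (wirtinger (dz j F (Function.update z j w)) (dzbar j F (Function.update z j w))) w := by
  have h := HasFDerivAt.comp w hF.hasFDerivAt (hasFDerivAt_update (𝕜 := ℝ) z (i := j) w)
  convert! h using 1
  ext1 x
  have hx : ContinuousLinearMap.pi (Pi.single j (ContinuousLinearMap.id ℝ ℂ)) x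
      = x.re • (Pi.single j 1 : Fin n → ℂ) + x.im • (Pi.single j Complex.I : Fin n → ℂ) := by
    ext i
    by_cases hi : i = j
    · subst hi
      simp
    · simp [hi]
  rw [ContinuousLinearMap.comp_apply, hx, map_add, map_smul, map_smul, wirtinger_apply, dz, dzbar]
  simp only [Complex.real_smul]
  have h₁ : x = x.re + x.im * Complex.I := (Complex.re_add_im x).symm
  have h₂ : conj x = x.re - x.im * Complex.I := by
    apply Complex.ext <;> simp
  rw [h₂]
  nth_rewrite 1 [h₁]
  linear_combination (-(x.im : ℂ) * fderiv ℝ F (Function.update z j w) (Pi.single j Complex.I))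
    * Complex.I_sq

theorem contDiffOn_dzbar {u : (Fin n → ℂ) → ℂ} (hu : ContDiffOn ℝ 2 u (polydisc n)) (j : Fin n) :
    ContDiffOn ℝ 1 (dzbar j u) (polydisc n) := by
  have h : ContDiffOn ℝ 1 (fderiv ℝ u) (polydisc n) :=
    hu.fderiv_of_isOpen isOpen_polydisc (by norm_num)
  unfold dzbar
  fun_prop

theorem continuousOn_dz {u : (Fin n → ℂ) → ℂ} (hu : ContDiffOn ℝ 1 u (polydisc n)) (j : Fin n) :
    ContinuousOn (dz j u) (polydisc n) := by
  have h : ContinuousOn (fderiv ℝ u) (polydisc n) :=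
    hu.continuousOn_fderiv_of_isOpen isOpen_polydisc le_rfl
  unfold dz
  fun_prop

theorem continuousOn_dzbar {u : (Fin n → ℂ) → ℂ} (hu : ContDiffOn ℝ 1 u (polydisc n))
    (j : Fin n) : ContinuousOn (dzbar j u) (polydisc n) := by
  have h : ContinuousOn (fderiv ℝ u) (polydisc n) :=
    hu.continuousOn_fderiv_of_isOpen isOpen_polydisc le_rfl
  unfold dzbar
  fun_prop

theorem IsSepHarmonic.isHarmonicJet {α β : Fin n → ℂ} {u : (Fin n → ℂ) → ℂ}
    (hu : IsSepHarmonic α β u) {z : Fin n → ℂ} (hz : z ∈ polydisc n) (j : Fin n) :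
    IsHarmonicJet (α j) (β j) (fun w => u (Function.update z j w))
      (fun w => dz j u (Function.update z j w)) (fun w => dzbar j u (Function.update z j w))
      (fun w => dz j (dzbar j u) (Function.update z j w))
      (fun w => dzbar j (dzbar j u) (Function.update z j w)) := by
  have h1 : ContDiffOn ℝ 1 u (polydisc n) := hu.1.of_le (by norm_num)
  have hmaps : MapsTo (fun w => Function.update z j w) (Metric.ball 0 1) (polydisc n) :=
    fun w hw => update_mem_polydisc hz j hw
  have hc : ContinuousOn (fun w : ℂ => Function.update z j w) (Metric.ball 0 1) := by
    fun_prop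
  have hdiff {F : (Fin n → ℂ) → ℂ} (hF : ContDiffOn ℝ 1 F (polydisc n)) {w : ℂ}
      (hw : w ∈ Metric.ball (0 : ℂ) 1) : DifferentiableAt ℝ F (Function.update z j w) :=
    (hF.differentiableOn one_ne_zero).differentiableAt (isOpen_polydisc.mem_nhds (hmaps hw))
  refine ⟨(continuousOn_dz h1 j).comp hc hmaps,
    (continuousOn_dz (contDiffOn_dzbar hu.1 j) j).comp hc hmaps,
    (continuousOn_dzbar (contDiffOn_dzbar hu.1 j) j).comp hc hmaps,
    fun w hw => hasFDerivAt_slice (hdiff h1 hw),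
    fun w hw => hasFDerivAt_slice (hdiff (contDiffOn_dzbar hu.1 j) hw), fun w hw => ?_⟩
  simpa [opL] using hu.2 j _ (hmaps hw)

end Slices

/-! ### Fourier coefficients on tori of arbitrary radii. -/

section TorusCoefficients

variable {n : ℕ}

/-- The point `(r₁ζ₁, …, rₙζₙ)`. -/
def polar (r : Fin n → ℝ) (ζ : Torus n) : Fin n → ℂ := fun j => (r j : ℂ) * (ζ j : ℂ)

/-- The `k`-th Fourier coefficient of `ζ ↦ v (r₁ζ₁, …, rₙζₙ)`. -/
def torusCoeff (v : (Fin n → ℂ) → ℂ) (k : Fin n → ℤ) (r : Fin n → ℝ) : ℂ :=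
  ∫ ζ, v (polar r ζ) * character (-k) ζ ∂torusMeasure n

theorem polar_mem_polydisc {r : Fin n → ℝ} (hr : ∀ j, r j ∈ Ico (0 : ℝ) 1) (ζ : Torus n) :
    polar r ζ ∈ polydisc n := by
  intro j
  rw [polar, norm_mul, Circle.norm_coe, mul_one, Complex.norm_real, Real.norm_of_nonneg (hr j).1]
  exact (hr j).2

theorem continuous_polar (r : Fin n → ℝ) : Continuous (polar r) := by
  unfold polar
  fun_prop

theorem continuous_comp_polar {v : (Fin n → ℂ) → ℂ} (hv : ContinuousOn v (polydisc n))
    {r : Fin n → ℝ} (hr : ∀ j, r j ∈ Ico (0 : ℝ) 1) : Continuous fun ζ => v (polar r ζ) :=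
  hv.comp_continuous (continuous_polar r) (polar_mem_polydisc hr)

theorem polar_mulSingle_mul (r : Fin n → ℝ) (j : Fin n) (w : Circle) (ζ : Torus n) :
    polar r (Pi.mulSingle j w * ζ) = Function.update (polar r ζ) j (ζ j * r j * w) := by
  ext i
  by_cases hi : i = j
  · subst hi
    simp [polar]
    ring
  · simp [polar, hi]

theorem character_mulSingle (k : Fin n → ℤ) (j : Fin n) (w : Circle) :
    character (-k) (Pi.mulSingle j w) = (w : ℂ) ^ (-k j) := by
  rw [character_apply, Finset.prod_eq_single j]
  · simp
  · intro i _ hi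
    simp [hi]
  · simp

theorem integrable_prod_circle_torus {f : Circle × Torus n → ℂ} (hf : Continuous f) :
    Integrable f (circleMeasure.prod (torusMeasure n)) :=
  hf.integrable_of_hasCompactSupport (HasCompactSupport.of_compactSpace _)

/-- Average over rotations of the j-th coordinate alone and exchange integrals. The slice on the
right does not involve r_j, which enters only through the evaluation point. -/
theorem torusCoeff_eq_integral_circleCoeff {v : (Fin n → ℂ) → ℂ}
    (hv : ContinuousOn v (polydisc n)) (k : Fin n → ℤ) {r : Fin n → ℝ}
    (hr : ∀ j, r j ∈ Ico (0 : ℝ) 1) (j : Fin n) :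
    torusCoeff v k r = ∫ ζ, character (-k) ζ * (ζ j : ℂ) ^ k j *
      circleCoeff (fun w => v (Function.update (polar r ζ) j w)) (k j) (r j) ∂torusMeasure n := by
  let G : Torus n → ℂ := fun ζ => v (polar r ζ) * character (-k) ζ
  have hG : Continuous G := (continuous_comp_polar hv hr).mul (character (-k)).continuous
  have hsingle : Continuous fun w : Circle => (Pi.mulSingle j w : Torus n) :=
    continuous_mulSingle (A := fun _ : Fin n => Circle) j
  have h₁ : torusCoeff v k r
      = ∫ w : Circle, ∫ ζ, G (Pi.mulSingle j w * ζ) ∂torusMeasure n ∂circleMeasure := by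
    have (w : Circle) : ∫ ζ, G (Pi.mulSingle j w * ζ) ∂torusMeasure n = torusCoeff v k r :=
      integral_mul_left_eq_self G _
    simp [this]
  have hc : Continuous fun p : Circle × Torus n => G (Pi.mulSingle j p.1 * p.2) :=
    hG.comp ((hsingle.comp continuous_fst).mul continuous_snd)
  rw [h₁, integral_integral_swap (f := fun (w : Circle) ζ => G ((Pi.mulSingle j w : Torus n) * ζ))
    (integrable_prod_circle_torus hc)]
  refine integral_congr_ae (.of_forall fun ζ => ?_)
  simp only [G, polar_mulSingle_mul, character_apply_mul, character_mulSingle]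
  rw [mul_assoc, ← circleCoeff_circle_mul, circleCoeff, ← integral_const_mul]
  refine integral_congr_ae (.of_forall fun w => ?_)
  simp only
  ring

theorem polar_update_update (r : Fin n → ℝ) (j : Fin n) (s : ℝ) (ζ : Torus n) (w : ℂ) :
    Function.update (polar (Function.update r j s) ζ) j w = Function.update (polar r ζ) j w := by
  ext i
  by_cases hi : i = j
  · subst hi
    simp
  · simp [polar, hi]

/-- The Fourier coefficients of the one variable Poisson kernel in the `j`-th variable. -/
def kernelCoeff (α β : Fin n → ℂ) (j : Fin n) (m : ℤ) (r : ℝ) : ℂ :=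
  coef (α j) (β j) * circleCoeff (diskKernel (α j) (β j)) m r

/-- One-variable proportionality to the kernel, applied in each slice and integrated over ζ; the
slices for r_j and s coincide. -/
theorem torusCoeff_mul_kernelCoeff {α β : Fin n → ℂ} {u : (Fin n → ℂ) → ℂ}
    (hu : IsSepHarmonic α β u) (k : Fin n → ℤ) {r : Fin n → ℝ} (hr : ∀ j, r j ∈ Ico (0 : ℝ) 1)
    (j : Fin n) {s : ℝ} (hs : s ∈ Ioo (0 : ℝ) 1) :
    torusCoeff u k r * kernelCoeff α β j (k j) s
      = torusCoeff u k (Function.update r j s) * kernelCoeff α β j (k j) (r j) := by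
  have hr' (i : Fin n) : Function.update r j s i ∈ Ico (0 : ℝ) 1 := by
    by_cases hi : i = j
    · subst hi
      simpa using Ioo_subset_Ico_self hs
    · simpa [hi] using hr i
  rw [torusCoeff_eq_integral_circleCoeff hu.1.continuousOn k hr j,
    torusCoeff_eq_integral_circleCoeff hu.1.continuousOn k hr' j, ← integral_mul_const,
    ← integral_mul_const]
  refine integral_congr_ae (.of_forall fun ζ => ?_)
  have h := ((hu.isHarmonicJet (polar_mem_polydisc hr ζ) j).radialSystem (k j)).mul_eq_mul
    ((isHarmonicJet_diskKernel (α j) (β j)).radialSystem (k j)) (hr j) hs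
  simp only [polar_update_update, Function.update_self, kernelCoeff]
  linear_combination (character (-k) ζ * (ζ j : ℂ) ^ k j * coef (α j) (β j)) * h

/-- The Fourier coefficients of a separately `(α, β)`-harmonic function are proportional to those
of the Poisson kernel. -/
theorem torusCoeff_mul_prod_kernelCoeff {α β : Fin n → ℂ} {u : (Fin n → ℂ) → ℂ}
    (hu : IsSepHarmonic α β u) (k : Fin n → ℤ) {r s : Fin n → ℝ}
    (hr : ∀ j, r j ∈ Ico (0 : ℝ) 1) (hs : ∀ j, s j ∈ Ioo (0 : ℝ) 1) :
    torusCoeff u k r * ∏ j, kernelCoeff α β j (k j) (s j)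
      = torusCoeff u k s * ∏ j, kernelCoeff α β j (k j) (r j) := by
  -- The radii are changed from r to s one coordinate at a time.
  have key (T : Finset (Fin n)) : torusCoeff u k r * ∏ j ∈ T, kernelCoeff α β j (k j) (s j)
      = torusCoeff u k (T.piecewise s r) * ∏ j ∈ T, kernelCoeff α β j (k j) (r j) := by
    induction T using Finset.induction_on with
    | empty => simp
    | insert j T hj ih =>
      have hp (i : Fin n) : T.piecewise s r i ∈ Ico (0 : ℝ) 1 := by
        by_cases hi : i ∈ T
        · simpa [hi] using Ioo_subset_Ico_self (hs i)
        · simpa [hi] using hr i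
      have h := torusCoeff_mul_kernelCoeff hu k hp j (hs j)
      rw [Finset.piecewise_eq_of_notMem _ _ _ hj] at h
      rw [Finset.prod_insert hj, Finset.prod_insert hj, Finset.piecewise_insert]
      linear_combination (kernelCoeff α β j (k j) (s j)) * ih
        + (∏ j ∈ T, kernelCoeff α β j (k j) (r j)) * h
  simpa using key Finset.univ

end TorusCoefficients

/-! ### Fourier coefficients of Poisson integrals. -/

section PoissonCoefficients

variable {n : ℕ}

theorem abPoissonKernel_eq (α β : Fin n → ℂ) (z : Fin n → ℂ) (η : Torus n) :
    abPoissonKernel α β z η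
      = ∏ j, coef (α j) (β j) * diskKernel (α j) (β j) (z j * conj (η j : ℂ)) := by
  refine Finset.prod_congr rfl fun j _ => ?_
  rw [diskKernel, map_mul, Complex.conj_conj, norm_mul, RCLike.norm_conj, Circle.norm_coe, mul_one]

theorem continuousOn_abPoissonKernel (α β : Fin n → ℂ) :
    ContinuousOn (fun p : (Fin n → ℂ) × Torus n => abPoissonKernel α β p.1 p.2)
      (polydisc n ×ˢ univ) := by
  simp only [abPoissonKernel_eq]
  refine continuousOn_finsetProd _ fun j _ => continuousOn_const.mul ?_
  have hc : Continuous fun p : (Fin n → ℂ) × Torus n => p.1 j * conj (p.2 j : ℂ) := by fun_prop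
  refine (continuousOn_diskKernel (α j) (β j)).comp hc.continuousOn fun p hp => ?_
  simpa [Circle.norm_coe] using hp.1 j

theorem continuous_of_continuousOn_polydisc {K : (Fin n → ℂ) → Torus n → ℂ}
    (hK : ContinuousOn (fun p : (Fin n → ℂ) × Torus n => K p.1 p.2) (polydisc n ×ˢ univ))
    {z : Fin n → ℂ} (hz : z ∈ polydisc n) : Continuous (K z) :=
  hK.comp_continuous (continuous_const.prodMk continuous_id) fun η => ⟨hz, mem_univ η⟩

theorem continuous_polar_of_continuousOn_polydisc {K : (Fin n → ℂ) → Torus n → ℂ}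
    (hK : ContinuousOn (fun p : (Fin n → ℂ) × Torus n => K p.1 p.2) (polydisc n ×ˢ univ))
    {r : Fin n → ℝ} (hr : ∀ j, r j ∈ Ico (0 : ℝ) 1) :
    Continuous fun p : Torus n × Torus n => K (polar r p.1) p.2 :=
  hK.comp_continuous (((continuous_polar r).comp continuous_fst).prodMk continuous_snd)
    fun p => ⟨polar_mem_polydisc hr p.1, mem_univ _⟩

theorem continuous_integral_torus (m : FiniteMeasure (Torus n)) {f : Torus n → Torus n → ℂ}
    (hf : Continuous fun p : Torus n × Torus n => f p.1 p.2) :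
    Continuous fun ζ => ∫ η, f ζ η ∂(m : Measure (Torus n)) := by
  obtain ⟨C, hC⟩ := isCompact_univ.exists_bound_of_continuousOn hf.continuousOn
  have h₁ (ζ : Torus n) : Continuous (f ζ) := hf.comp (continuous_const.prodMk continuous_id)
  have h₂ (η : Torus n) : Continuous fun ζ => f ζ η :=
    hf.comp (continuous_id.prodMk continuous_const)
  exact continuous_of_dominated (bound := fun _ => C) (fun ζ => (h₁ ζ).aestronglyMeasurable)
    (fun ζ => .of_forall fun η => hC (ζ, η) (mem_univ _)) (integrable_const _)
    (.of_forall h₂)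

/-- The Poisson kernel at `z` as a continuous function on the torus. -/
def kernelFunction (α β : Fin n → ℂ) {z : Fin n → ℂ} (hz : z ∈ polydisc n) : C(Torus n, ℂ) :=
  ⟨abPoissonKernel α β z, continuous_of_continuousOn_polydisc (continuousOn_abPoissonKernel α β) hz⟩

theorem poissonIntegral_quadMeasure (α β : Fin n → ℂ) (m : Fin 4 → FiniteMeasure (Torus n))
    {z : Fin n → ℂ} (hz : z ∈ polydisc n) : poissonIntegral α β (quadMeasure m) z
      = ∑ i : Fin 4, Complex.I ^ (i : ℕ) *
        ∫ η, abPoissonKernel α β z η ∂(m i : Measure (Torus n)) := by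
  have h := integral_quadMeasure_eq m (kernelFunction α β hz)
  rw [quadFunctional_apply] at h
  exact h

theorem continuous_abPoissonKernel_polar (α β : Fin n → ℂ) {r : Fin n → ℝ}
    (hr : ∀ j, r j ∈ Ico (0 : ℝ) 1) :
    Continuous fun p : Torus n × Torus n => abPoissonKernel α β (polar r p.1) p.2 :=
  continuous_polar_of_continuousOn_polydisc (continuousOn_abPoissonKernel α β) hr

/-- Rotating by η moves the pole to (1, …, 1) and pulls out the character; the rest factors over the
coordinates. -/
theorem integral_abPoissonKernel_mul_character (α β : Fin n → ℂ) (k : Fin n → ℤ)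
    (r : Fin n → ℝ) (η : Torus n) :
    ∫ ζ, abPoissonKernel α β (polar r ζ) η * character (-k) ζ ∂torusMeasure n
      = character (-k) η * ∏ j, kernelCoeff α β j (k j) (r j) := by
  rw [← integral_mul_left_eq_self _ η]
  have h (ζ : Torus n) : abPoissonKernel α β (polar r (η * ζ)) η * character (-k) (η * ζ)
      = character (-k) η * ∏ j, (coef (α j) (β j) *
        (diskKernel (α j) (β j) (r j * ζ j) * (ζ j : ℂ) ^ (-k j))) := by
    have hη (j : Fin n) : polar r (η * ζ) j * conj (η j : ℂ) = r j * ζ j := by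
      rw [← Circle.coe_inv_eq_conj, Circle.coe_inv]
      simp only [polar, Pi.mul_apply, Circle.coe_mul]
      field_simp [Circle.coe_ne_zero]
    rw [abPoissonKernel_eq, character_apply_mul, mul_left_comm, character_apply (-k) ζ,
      ← Finset.prod_mul_distrib]
    congr 1
    refine Finset.prod_congr rfl fun j _ => ?_
    rw [hη, Circle.coe_zpow, Pi.neg_apply, mul_assoc]
  simp only [h]
  rw [integral_const_mul, torusMeasure_eq_pi, integral_fintype_prod_eq_prod (𝕜 := ℂ)
    (fun j (w : Circle) => coef (α j) (β j) *
      (diskKernel (α j) (β j) (r j * w) * (w : ℂ) ^ (-k j)))]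
  simp only [integral_const_mul]
  rfl

theorem integrable_prod_torus (m : FiniteMeasure (Torus n)) {f : Torus n × Torus n → ℂ}
    (hf : Continuous f) : Integrable f ((torusMeasure n).prod (m : Measure (Torus n))) :=
  hf.integrable_of_hasCompactSupport (HasCompactSupport.of_compactSpace _)

theorem continuous_integral_abPoissonKernel (α β : Fin n → ℂ) (m : FiniteMeasure (Torus n))
    {r : Fin n → ℝ} (hr : ∀ j, r j ∈ Ico (0 : ℝ) 1) :
    Continuous fun ζ => ∫ η, abPoissonKernel α β (polar r ζ) η ∂(m : Measure (Torus n)) :=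
  continuous_integral_torus m (continuous_abPoissonKernel_polar α β hr)

theorem continuous_poissonIntegral_polar (α β : Fin n → ℂ) (m : Fin 4 → FiniteMeasure (Torus n))
    {r : Fin n → ℝ} (hr : ∀ j, r j ∈ Ico (0 : ℝ) 1) :
    Continuous fun ζ => poissonIntegral α β (quadMeasure m) (polar r ζ) := by
  simp only [poissonIntegral_quadMeasure α β m (polar_mem_polydisc hr _)]
  exact continuous_finsetSum _ fun i _ =>
    continuous_const.mul (continuous_integral_abPoissonKernel α β (m i) hr)

/-- The Fourier coefficients of a Poisson integral. -/
theorem torusCoeff_poissonIntegral (α β : Fin n → ℂ) (m : Fin 4 → FiniteMeasure (Torus n))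
    (k : Fin n → ℤ) {r : Fin n → ℝ} (hr : ∀ j, r j ∈ Ico (0 : ℝ) 1) :
    torusCoeff (poissonIntegral α β (quadMeasure m)) k r
      = quadFunctional m (character (-k)) * ∏ j, kernelCoeff α β j (k j) (r j) := by
  have hc : Continuous fun p : Torus n × Torus n =>
      abPoissonKernel α β (polar r p.1) p.2 * character (-k) p.1 :=
    (continuous_abPoissonKernel_polar α β hr).mul
      ((character (-k)).continuous.comp continuous_fst)
  have hi (i : Fin 4) : ∫ ζ, (∫ η, abPoissonKernel α β (polar r ζ) η ∂(m i : Measure (Torus n)))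
      * character (-k) ζ ∂torusMeasure n
      = (∫ η, character (-k) η ∂(m i : Measure (Torus n)))
        * ∏ j, kernelCoeff α β j (k j) (r j) := by
    simp only [← integral_mul_const]
    rw [integral_integral_swap (f := fun ζ η => abPoissonKernel α β (polar r ζ) η *
      character (-k) ζ) (integrable_prod_torus (m i) hc)]
    simp only [integral_abPoissonKernel_mul_character]
  rw [torusCoeff, quadFunctional_apply, Finset.sum_mul]
  simp only [poissonIntegral_quadMeasure α β m (polar_mem_polydisc hr _), Finset.sum_mul,
    mul_assoc]
  rw [integral_finsetSum]
  · refine Finset.sum_congr rfl fun i _ => ?_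
    rw [integral_const_mul, hi]
  · intro i _
    exact continuous_integrable (continuous_const.mul
      ((continuous_integral_abPoissonKernel α β (m i) hr).mul (character (-k)).continuous))

end PoissonCoefficients

/-! ### Weak compactness of L¹-bounded families. -/

section WeakLimits

open scoped NNReal

variable {n : ℕ}

/-- The four terms are the positive and negative parts of Re w and Im w, each at most |w|. They
serve as densities of the four positive measures. -/
theorem sum_I_pow_mul_toNNReal (w : ℂ) :
    ∑ i : Fin 4, Complex.I ^ (i : ℕ) * ((conj (Complex.I ^ (i : ℕ)) * w).re.toNNReal : ℂ) = w := by
  have h (x : ℝ) : ((x.toNNReal : ℝ) : ℂ) - (((-x).toNNReal : ℝ) : ℂ) = (x : ℂ) := by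
    rw [← Complex.ofReal_sub, Real.coe_toNNReal', Real.coe_toNNReal', max_zero_sub_eq_self]
  have h₁ := h w.re
  have h₂ := h w.im
  conv_rhs => rw [← Complex.re_add_im w, ← h₁, ← h₂]
  simp [Fin.sum_univ_four, pow_succ]
  ring

/-- A continuous density is the density of a complex measure `m₀ + i m₁ - m₂ - i m₃`, with mass
control by the `L¹` norm. -/
theorem exists_quadFunctional_eq_integral {v : Torus n → ℂ} (hv : Continuous v) {C : ℝ≥0}
    (hC : ∫⁻ ζ, ‖v ζ‖ₑ ∂torusMeasure n ≤ C) :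
    ∃ m : Fin 4 → FiniteMeasure (Torus n), (∀ i, (m i).mass ≤ C) ∧
      ∀ F : C(Torus n, ℂ), quadFunctional m F = ∫ ζ, v ζ * F ζ ∂torusMeasure n := by
  let d (i : Fin 4) (ζ : Torus n) : ℝ≥0 := (conj (Complex.I ^ (i : ℕ)) * v ζ).re.toNNReal
  have hd (i : Fin 4) : Continuous (d i) :=
    continuous_real_toNNReal.comp (Complex.continuous_re.comp (continuous_const.mul hv))
  have hle (i : Fin 4) (ζ : Torus n) : (d i ζ : ENNReal) ≤ ‖v ζ‖ₑ := by
    rw [← ofReal_norm]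
    refine ENNReal.ofReal_le_ofReal ((Complex.re_le_norm _).trans ?_)
    simp
  have hmass (i : Fin 4) : (torusMeasure n).withDensity (fun ζ => (d i ζ : ENNReal)) univ ≤ C := by
    rw [withDensity_apply _ .univ, Measure.restrict_univ]
    exact (lintegral_mono (hle i)).trans hC
  have hm (i : Fin 4) : ∃ m : FiniteMeasure (Torus n),
      (m : Measure (Torus n)) = (torusMeasure n).withDensity fun ζ => (d i ζ : ENNReal) :=
    ⟨⟨_, ⟨(hmass i).trans_lt ENNReal.coe_lt_top⟩⟩, rfl⟩
  choose m hm using hm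
  refine ⟨m, fun i => ?_, fun F => ?_⟩
  · rw [← ENNReal.coe_le_coe, FiniteMeasure.ennreal_mass, hm]
    exact hmass i
  · have hint (i : Fin 4) :
        Integrable (fun ζ => Complex.I ^ (i : ℕ) * (d i ζ • F ζ)) (torusMeasure n) :=
      continuous_integrable (continuous_const.mul ((hd i).smul F.continuous))
    rw [quadFunctional_apply]
    simp only [hm,
      integral_withDensity_eq_integral_smul (hd _).measurable, ← integral_const_mul]
    rw [← integral_finsetSum _ fun i _ => hint i]
    refine integral_congr_ae (.of_forall fun ζ => ?_)
    simp only
    conv_rhs => rw [← sum_I_pow_mul_toNNReal (v ζ), Finset.sum_mul]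
    refine Finset.sum_congr rfl fun i _ => ?_
    rw [NNReal.smul_def, Complex.real_smul, mul_assoc]

theorem tendsto_quadFunctional {ι : Type*} {l : Filter ι} {M : ι → Fin 4 → FiniteMeasure (Torus n)}
    {m : Fin 4 → FiniteMeasure (Torus n)} (h : ∀ i, Tendsto (fun r => M r i) l (𝓝 (m i)))
    (F : C(Torus n, ℂ)) :
    Tendsto (fun r => quadFunctional (M r) F) l (𝓝 (quadFunctional m F)) := by
  simp only [quadFunctional_apply]
  exact tendsto_finsetSum _ fun i _ => tendsto_const_nhds.mul
    ((FiniteMeasure.tendsto_iff_forall_integral_rclike_tendsto ℂ).1 (h i)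
      (BoundedContinuousFunction.mkOfCompact F))

/-- Functions bounded in `L¹` have a weak limit point among the complex measures. -/
theorem exists_weak_limit {v : ℝ → Torus n → ℂ}
    (hv : ∀ r ∈ Ico (0 : ℝ) 1, Continuous (v r)) {C : ℝ≥0}
    (hC : ∀ r ∈ Ico (0 : ℝ) 1, ∫⁻ ζ, ‖v r ζ‖ₑ ∂torusMeasure n ≤ C) :
    ∃ (m : Fin 4 → FiniteMeasure (Torus n)) (l : Ultrafilter ℝ), ↑l ≤ 𝓝[<] (1 : ℝ) ∧
      ∀ F : C(Torus n, ℂ), Tendsto (fun r => ∫ ζ, v r ζ * F ζ ∂torusMeasure n) l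
        (𝓝 (quadFunctional m F)) := by
  have h (r : ℝ) : ∃ m : Fin 4 → FiniteMeasure (Torus n), r ∈ Ico (0 : ℝ) 1 →
      (∀ i, (m i).mass ≤ C) ∧
      ∀ F : C(Torus n, ℂ), quadFunctional m F = ∫ ζ, v r ζ * F ζ ∂torusMeasure n := by
    by_cases hr : r ∈ Ico (0 : ℝ) 1
    · obtain ⟨m, hm⟩ := exists_quadFunctional_eq_integral (hv r hr) (hC r hr)
      exact ⟨m, fun _ => hm⟩
    · exact ⟨fun _ => 0, fun h => absurd h hr⟩
  choose M hM using h
  -- An ultrafilter makes all four families converge simultaneously, without extracting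
  -- subsequences.
  let l : Ultrafilter ℝ := .of (𝓝[<] 1)
  have hl : (l : Filter ℝ) ≤ 𝓝[<] 1 := Ultrafilter.of_le _
  have hmem : ∀ᶠ r in l, r ∈ Ico (0 : ℝ) 1 := hl (Ico_mem_nhdsLT zero_lt_one)
  have hlim (i : Fin 4) : ∃ m : FiniteMeasure (Torus n), Tendsto (fun r => M r i) l (𝓝 m) := by
    obtain ⟨m, -, hm⟩ := (isCompact_setOfPred_finiteMeasure_le_of_compactSpace (Torus n)
      C).ultrafilter_le_nhds' (l.map fun r => M r i) (hmem.mono fun r hr => (hM r hr).1 i)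
    exact ⟨m, hm⟩
  choose m hm using hlim
  refine ⟨m, l, hl, fun F => (tendsto_quadFunctional hm F).congr' ?_⟩
  filter_upwards [hmem] with r hr using (hM r hr).2 F

end WeakLimits

/-! ### Existence and uniqueness of the representing measure. -/

section Representation

variable {n : ℕ} {α β : Fin n → ℂ} {u : (Fin n → ℂ) → ℂ}

theorem exists_polar_eq {z : Fin n → ℂ} (hz : z ∈ polydisc n) :
    ∃ r : Fin n → ℝ, (∀ j, r j ∈ Ico (0 : ℝ) 1) ∧ ∃ ζ, polar r ζ = z := by
  refine ⟨fun j => ‖z j‖, fun j => ⟨norm_nonneg _, hz j⟩, fun j => Circle.exp (z j).arg, ?_⟩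
  ext j
  simp [polar, Complex.norm_mul_exp_arg_mul_I]

theorem eq_poissonIntegral_of_torusCoeff_eq (hu : ContinuousOn u (polydisc n))
    {m : Fin 4 → FiniteMeasure (Torus n)}
    (h : ∀ k : Fin n → ℤ, ∀ r : Fin n → ℝ, (∀ j, r j ∈ Ico (0 : ℝ) 1) → torusCoeff u k r
      = quadFunctional m (character (-k)) * ∏ j, kernelCoeff α β j (k j) (r j))
    {z : Fin n → ℂ} (hz : z ∈ polydisc n) : u z = poissonIntegral α β (quadMeasure m) z := by
  obtain ⟨r, hr, ζ, rfl⟩ := exists_polar_eq hz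
  refine congrFun (eq_of_fourierCoeff_eq (continuous_comp_polar hu hr)
    (continuous_poissonIntegral_polar α β m hr) fun k => ?_) ζ
  have := (h (-k) r hr).trans (torusCoeff_poissonIntegral α β m (-k) hr).symm
  simpa only [torusCoeff, neg_neg] using this

/-- The coefficient tends to 1, hence is nonzero near the boundary. One such radius per variable
suffices for every division below. -/
theorem exists_kernelCoeff_ne_zero (hre : ∀ j, -1 < (α j).re + (β j).re)
    (hα : ∀ (j : Fin n) (k : ℕ), α j ≠ -((k : ℂ) + 1))
    (hβ : ∀ (j : Fin n) (k : ℕ), β j ≠ -((k : ℂ) + 1)) (j : Fin n) (m : ℤ) :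
    ∃ s ∈ Ioo (0 : ℝ) 1, kernelCoeff α β j m s ≠ 0 := by
  have h := tendsto_coef_mul_circleCoeff_diskKernel (hre j) (hα j) (hβ j) m
  have h₁ := (h.eventually_ne one_ne_zero).and (Ioo_mem_nhdsLT (zero_lt_one (α := ℝ)))
  obtain ⟨s, hs, hs'⟩ := h₁.exists
  exact ⟨s, hs', hs⟩

/-- The Fourier coefficients of a separately `(α, β)`-harmonic function are the products of those
of the Poisson kernel with constants. -/
theorem exists_torusCoeff_eq (hre : ∀ j, -1 < (α j).re + (β j).re)
    (hα : ∀ (j : Fin n) (k : ℕ), α j ≠ -((k : ℂ) + 1))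
    (hβ : ∀ (j : Fin n) (k : ℕ), β j ≠ -((k : ℂ) + 1)) (hu : IsSepHarmonic α β u)
    (k : Fin n → ℤ) : ∃ c : ℂ, ∀ r : Fin n → ℝ, (∀ j, r j ∈ Ico (0 : ℝ) 1) →
      torusCoeff u k r = c * ∏ j, kernelCoeff α β j (k j) (r j) := by
  choose s hs hs' using fun j => exists_kernelCoeff_ne_zero hre hα hβ j (k j)
  have hne : ∏ j, kernelCoeff α β j (k j) (s j) ≠ 0 := Finset.prod_ne_zero_iff.2 fun j _ => hs' j
  refine ⟨torusCoeff u k s / ∏ j, kernelCoeff α β j (k j) (s j), fun r hr => ?_⟩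
  have := torusCoeff_mul_prod_kernelCoeff hu k hr hs
  field_simp
  linear_combination this

theorem tendsto_prod_kernelCoeff (hre : ∀ j, -1 < (α j).re + (β j).re)
    (hα : ∀ (j : Fin n) (k : ℕ), α j ≠ -((k : ℂ) + 1))
    (hβ : ∀ (j : Fin n) (k : ℕ), β j ≠ -((k : ℂ) + 1)) (k : Fin n → ℤ) :
    Tendsto (fun r : ℝ => ∏ j, kernelCoeff α β j (k j) r) (𝓝[<] 1) (𝓝 1) := by
  have h := tendsto_finsetProd Finset.univ fun j _ =>
    tendsto_coef_mul_circleCoeff_diskKernel (hre j) (hα j) (hβ j) (k j)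
  rwa [Finset.prod_const_one] at h

theorem quadMeasure_eq_of_eq_poissonIntegral (hre : ∀ j, -1 < (α j).re + (β j).re)
    (hα : ∀ (j : Fin n) (k : ℕ), α j ≠ -((k : ℂ) + 1))
    (hβ : ∀ (j : Fin n) (k : ℕ), β j ≠ -((k : ℂ) + 1)) {m m' : Fin 4 → FiniteMeasure (Torus n)}
    (h : ∀ z ∈ polydisc n, poissonIntegral α β (quadMeasure m) z
      = poissonIntegral α β (quadMeasure m') z) : quadMeasure m = quadMeasure m' := by
  refine quadMeasure_eq_of_quadFunctional_eq (clm_ext_character fun k => ?_)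
  choose s hs hs' using fun j => exists_kernelCoeff_ne_zero hre hα hβ j ((-k) j)
  have hne : ∏ j, kernelCoeff α β j ((-k) j) (s j) ≠ 0 :=
    Finset.prod_ne_zero_iff.2 fun j _ => hs' j
  have hr (j : Fin n) : s j ∈ Ico (0 : ℝ) 1 := Ioo_subset_Ico_self (hs j)
  have h₁ := torusCoeff_poissonIntegral α β m (-k) hr
  have h₂ := torusCoeff_poissonIntegral α β m' (-k) hr
  have h₃ : torusCoeff (poissonIntegral α β (quadMeasure m)) (-k) s
      = torusCoeff (poissonIntegral α β (quadMeasure m')) (-k) s := by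
    simp only [torusCoeff, h _ (polar_mem_polydisc hr _)]
  rw [neg_neg] at h₁ h₂
  exact mul_right_cancel₀ hne (h₁.symm.trans (h₃.trans h₂))

theorem exists_quadMeasure_poissonIntegral_eq (hre : ∀ j, -1 < (α j).re + (β j).re)
    (hα : ∀ (j : Fin n) (k : ℕ), α j ≠ -((k : ℂ) + 1))
    (hβ : ∀ (j : Fin n) (k : ℕ), β j ≠ -((k : ℂ) + 1)) (hu : IsSepHarmonic α β u)
    (hbdd : (⨆ r ∈ Ico (0 : ℝ) 1, ∫⁻ ζ, ‖u (dilate r ζ)‖ₑ ∂torusMeasure n) < ⊤) :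
    ∃ m : Fin 4 → FiniteMeasure (Torus n),
      ∀ z ∈ polydisc n, u z = poissonIntegral α β (quadMeasure m) z := by
  obtain ⟨m, l, hl, hm⟩ := exists_weak_limit (v := fun r ζ => u (dilate r ζ))
    (fun r hr => continuous_comp_polar (r := fun _ => r) hu.1.continuousOn fun _ => hr)
    (C := (⨆ r ∈ Ico (0 : ℝ) 1, ∫⁻ ζ, ‖u (dilate r ζ)‖ₑ ∂torusMeasure n).toNNReal) fun r hr => by
      rw [ENNReal.coe_toNNReal hbdd.ne]
      exact le_iSup₂ (f := fun r (_ : r ∈ Ico (0 : ℝ) 1) =>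
        ∫⁻ ζ, ‖u (dilate r ζ)‖ₑ ∂torusMeasure n) r hr
  refine ⟨m, fun z hz => eq_poissonIntegral_of_torusCoeff_eq hu.1.continuousOn
    (fun k r hr => ?_) hz⟩
  obtain ⟨c, hc⟩ := exists_torusCoeff_eq hre hα hβ hu k
  have h₁ : Tendsto (fun r : ℝ => c * ∏ j, kernelCoeff α β j (k j) r) l (𝓝 (c * 1)) :=
    ((tendsto_prod_kernelCoeff hre hα hβ k).mono_left hl).const_mul c
  -- On equal radii the coefficient has two limits along `l`: the Fourier coefficient of the weak
  -- limit, and c since the kernel coefficients tend to 1.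
  have h₂ : quadFunctional m (character (-k)) = c * 1 := by
    refine tendsto_nhds_unique ((hm (character (-k))).congr' ?_) h₁
    filter_upwards [hl (Ico_mem_nhdsLT zero_lt_one)] with r hr using hc (fun _ => r) fun _ => hr
  rw [h₂, mul_one, hc r hr]

end Representation

end SepHarmonic

end

theorem theorem3p13 (n : ℕ) (α β : Fin n → ℂ)
    (hre : ∀ j, -1 < (α j).re + (β j).re)
    (hα : ∀ (j : Fin n) (k : ℕ), α j ≠ -((k : ℂ) + 1))
    (hβ : ∀ (j : Fin n) (k : ℕ), β j ≠ -((k : ℂ) + 1))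
    (u : (Fin n → ℂ) → ℂ) (hu : SepHarmonic.IsSepHarmonic α β u)
    (hbdd : (⨆ r ∈ Set.Ico (0 : ℝ) 1,
      ∫⁻ ζ, ‖u (SepHarmonic.dilate r ζ)‖ₑ ∂(SepHarmonic.torusMeasure n)) < ⊤) :
    ∃! μ : ComplexMeasure (SepHarmonic.Torus n),
      ∀ z ∈ SepHarmonic.polydisc n, u z = SepHarmonic.poissonIntegral α β μ z := by
  obtain ⟨m, hm⟩ := SepHarmonic.exists_quadMeasure_poissonIntegral_eq hre hα hβ hu hbdd
  refine ⟨SepHarmonic.quadMeasure m, hm, fun μ hμ => ?_⟩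
  obtain ⟨m', rfl⟩ := SepHarmonic.exists_quadMeasure_eq μ
  exact SepHarmonic.quadMeasure_eq_of_eq_poissonIntegral hre hα hβ
    fun z hz => (hμ z hz).symm.trans (hm z hz)
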